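/- Let $L,\rho_1,\rho_3,h_1,h_2,h_3,\alpha^1,\alpha^3_1,\beta,\mu,G_2,k_1,k_2,k_3,k_4>0$, $\rho_2\ge 0$ and $\gamma\in\mathbb R$, and put $\alpha^3=\alpha^3_1+\gamma^2\beta$, $H=\frac{h_1+2h_2+h_3}{2}$, $m=\rho_1h_1+\rho_2h_2+\rho_3h_3$, $K_1=\frac{\rho_1h_1^3+\rho_3h_3^3}{12}$, $K_2=\frac{\alpha^1h_1^3+\alpha^3h_3^3}{12}$. Consider the fully dynamic Rao-Nakra model of a piezoelectric smart beam, on $0<x<L$, $t>0$, $$\begin{cases}\rho_1h_1\ddot v^1-\alpha^1h_1v^1_{xx}-G_2\phi^2=0,\\ \rho_3h_3\ddot v^3-\alpha^3h_3v^3_{xx}+\gamma\beta h_3p_{xx}+G_2\phi^2=0,\\ \mu h_3\ddot p-\beta h_3p_{xx}+\gamma\beta h_3v^3_{xx}=0,\\ m\ddot w-K_1\ddot w_{xx}+K_2w_{xxxx}-G_2H\phi^2_x=0,\end{cases}\qquad \phi^2=\tfrac1{h_2}(-v^1+v^3+Hw_x),$$ clamped at $x=0$, i.e. $v^1=v^3=p=w=w_x=0$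 there, with the feedback boundary conditions at $x=L$ $$\alpha^1h_1v^1_x=-k_1\dot v^1,\quad \alpha^3h_3v^3_x-\gamma\beta h_3p_x=0,\quad \beta h_3p_x-\gamma\beta h_3v^3_x=-k_2\dot p,$$ $$K_2w_{xx}=-k_3\dot w_x,\quad K_1\ddot w_x-K_2w_{xxx}+G_2H\phi^2=-k_4\dot w.$$ Let $H^1_L=\{u\in H^1(0,L):u(0)=0\}$, $H^2_L=\{u\in H^2(0,L):u(0)=u_x(0)=0\}$ (complex-valued functions), and let the energy space $\mathcal H=\big((H^1_L)^3\times H^2_L\big)\times\big(L^2(0,L)^3\times H^1_L\big)$ of states $\varphi=(v^1,v^3,p,w,\dot v^1,\dot v^3,\dot p,\dot w)$ carry the norm $$\|\varphi\|_{\mathcal H}^2=\int_0^L\Big\{\rho_1h_1|\dot v^1|^2+\rho_3h_3|\dot v^3|^2+\mu h_3|\dot p|^2+m|\dot w|^2+K_1|\dot w_x|^2+\alpha^1h_1|v^1_x|^2+K_2|w_{xx}|^2+\tfrac{G_2}{h_2}|-v^1+v^3+Hw_x|^2$$ $$\qquad+\alpha^3h_3|v^3_x|^2-2\gamma\beta h_3\,\mathrm{Re}(v^3_x\bar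 p_x)+\beta h_3|p_x|^2\Big\}\,dx .$$ (a) The inertial sliding solutions are strongly stable: every mild solution $\varphi\in C([0,\infty);\mathcal H)$ of the closed-loop system with $w(x,t)=0$ for all $x\in[0,L]$ and $t\ge0$ satisfies $\|\varphi(t)\|_{\mathcal H}\to0$ as $t\to\infty$. (A mild solution is a $\varphi\in C([0,\infty);\mathcal H)$ such that for every $t\ge 0$ the integral $\int_0^t\varphi(s)\,ds$ lies in the domain of the closed-loop operator and is mapped by it to $\varphi(t)-\varphi(0)$; this operator is understood through the variational form of the system.) (b) If $\gamma\ne0$, the overdetermined eigenvalue problem for inertial sliding has only the trivial solution: if $\tau\in\mathbb R$ and $v^1,v^3,p\in H^2(0,L)$ satisfy, almost everywhere on $(0,L)$, $$\begin{cases}\alpha^1h_1v^1_{xx}+\frac{G_2}{h_2}(-v^1+v^3)=-\tau^2\rho_1h_1v^1,\\ \alpha^3h_3v^3_{xx}-\gamma\beta h_3p_{xx}-\frac{G_2}{h_2}(-v^1+v^3)=-\tau^2\rho_3h_3v^3,\\ \beta h_3p_{xx}-\gamma\beta h_3v^3_{xx}=-\tau^2\mu h_3p,\\ \frac{G_2H}{h_2}(-v^1+v^3)_x=0,\end{cases}$$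 together with $v^1=v^3=p=0$ at $x=0$ and $v^1_x=v^3_x=p_x=p=0$ at $x=L$, then $v^1=v^3=p=0$ on $[0,L]$. -/

import Mathlib

open Set Filter Topology MeasureTheory

noncomputable section

namespace RaoNakra

/-- Material parameters of the three-layer smart beam of length `L` and the feedback gains
`k1, …, k4`. Layer 1 is the elastic layer, layer 2 the compliant core, layer 3 the piezoelectric
layer; `hi` and `ρi` are thicknesses and densities, `α1` is the stiffness of layer 1, `α31` the
purely elastic stiffness of layer 3, `γ` the piezoelectric constant (of either sign), `β` the
impermittivity, `μ` the magnetic permeability, `G2` the shear modulus of the core. -/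
structure Params where
  L : ℝ
  ρ1 : ℝ
  ρ2 : ℝ
  ρ3 : ℝ
  h1 : ℝ
  h2 : ℝ
  h3 : ℝ
  α1 : ℝ
  α31 : ℝ
  γ : ℝ
  β : ℝ
  μ : ℝ
  G2 : ℝ
  k1 : ℝ
  k2 : ℝ
  k3 : ℝ
  k4 : ℝ
  L_pos : 0 < L
  ρ1_pos : 0 < ρ1
  ρ2_nonneg : 0 ≤ ρ2
  ρ3_pos : 0 < ρ3
  h1_pos : 0 < h1
  h2_pos : 0 < h2
  h3_pos : 0 < h3
  α1_pos : 0 < α1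
  α31_pos : 0 < α31
  β_pos : 0 < β
  μ_pos : 0 < μ
  G2_pos : 0 < G2
  k1_pos : 0 < k1
  k2_pos : 0 < k2
  k3_pos : 0 < k3
  k4_pos : 0 < k4

namespace Params

/-- Effective stiffness of the piezoelectric layer, `α³ = α₁³ + γ² β`. -/
def α3 (P : Params) : ℝ := P.α31 + P.γ ^ 2 * P.β

/-- `H = (h₁ + 2 h₂ + h₃) / 2`. -/
def H (P : Params) : ℝ := (P.h1 + 2 * P.h2 + P.h3) / 2

/-- Mass per unit length of the composite. -/
def m (P : Params) : ℝ := P.ρ1 * P.h1 + P.ρ2 * P.h2 + P.ρ3 * P.h3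

/-- Rotational inertia. -/
def K1 (P : Params) : ℝ := P.ρ1 * P.h1 ^ 3 / 12 + P.ρ3 * P.h3 ^ 3 / 12

/-- Bending stiffness. -/
def K2 (P : Params) : ℝ := P.α1 * P.h1 ^ 3 / 12 + P.α3 * P.h3 ^ 3 / 12

end Params

/-! ### Function spaces on `(0, L)` -/

/-- The space derivative on `[0, L]` (one-sided at the end points). -/
def dx (L : ℝ) (u : ℝ → ℂ) : ℝ → ℂ := derivWithin u (Icc 0 L)

/-- `u ∈ 𝕃²(0, L)`. -/
def MemL2 (L : ℝ) (u : ℝ → ℂ) : Prop := MemLp u 2 (volume.restrict (Ioo 0 L))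

/-- `u ∈ H¹(0, L)`, for the continuous representative: `u` is absolutely continuous on `[0, L]`
and its (almost everywhere defined) derivative is square integrable. -/
def MemH1 (L : ℝ) (u : ℝ → ℂ) : Prop :=
  AbsolutelyContinuousOnInterval u 0 L ∧ MemL2 L (dx L u)

/-- `u ∈ H²(0, L)`, for the continuously differentiable representative. -/
def MemH2 (L : ℝ) (u : ℝ → ℂ) : Prop :=
  DifferentiableOn ℝ u (Icc 0 L) ∧ MemH1 L (dx L u)

/-- `H¹_L(0, L) = {u ∈ H¹(0, L) : u(0) = 0}`. -/
def MemH1L (L : ℝ) (u : ℝ → ℂ) : Prop := MemH1 L u ∧ u 0 = 0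

/-- `H²_L(0, L) = {u ∈ H²(0, L) : u(0) = u_x(0) = 0}`. -/
def MemH2L (L : ℝ) (u : ℝ → ℂ) : Prop := MemH2 L u ∧ u 0 = 0 ∧ dx L u 0 = 0

/-! ### The energy space -/

/-- Names of the four unknowns: the longitudinal displacements `v1`, `v3` of the outer layers, the
total charge `p`, the transverse displacement `w`. -/
inductive Comp where
  | v1 : Comp
  | v3 : Comp
  | p : Comp
  | w : Comp

/-- Quadruples `(v¹, v³, p, w)` of complex functions of `x`. -/
abbrev Quad : Type := Comp → ℝ → ℂ

/-- States `(z, ż)`: a displacement quadruple and a velocity quadruple. -/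
abbrev State : Type := Quad × Quad

/-- `V = (H¹_L)³ × H²_L`. -/
def MemV (L : ℝ) (z : Quad) : Prop :=
  MemH1L L (z .v1) ∧ MemH1L L (z .v3) ∧ MemH1L L (z .p) ∧ MemH2L L (z .w)

/-- `H = (𝕃²)³ × H¹_L`. -/
def MemH (L : ℝ) (z : Quad) : Prop :=
  MemL2 L (z .v1) ∧ MemL2 L (z .v3) ∧ MemL2 L (z .p) ∧ MemH1L L (z .w)

/-- The energy space `ℋ = V × H`. -/
def MemE (L : ℝ) (φ : State) : Prop := MemV L φ.1 ∧ MemH L φ.2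

/-- The kinetic inner product on `H`; it is also the pairing `⟨M u, v⟩` with the mass operator. -/
def innerH (P : Params) (u v : Quad) : ℂ :=
  ∫ x in (0 : ℝ)..P.L,
    ((P.ρ1 * P.h1 : ℝ) * u .v1 x * star (v .v1 x)
      + (P.ρ3 * P.h3 : ℝ) * u .v3 x * star (v .v3 x)
      + (P.μ * P.h3 : ℝ) * u .p x * star (v .p x)
      + P.m * u .w x * star (v .w x)
      + P.K1 * dx P.L (u .w) x * star (dx P.L (v .w) x))

/-- The potential inner product on `V`; it is also the pairing `⟨A u, v⟩_{V', V}`. -/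
def innerV (P : Params) (u v : Quad) : ℂ :=
  ∫ x in (0 : ℝ)..P.L,
    ((P.α1 * P.h1 : ℝ) * dx P.L (u .v1) x * star (dx P.L (v .v1) x)
      + P.K2 * dx P.L (dx P.L (u .w)) x * star (dx P.L (dx P.L (v .w)) x)
      + (P.G2 / P.h2 : ℝ) * (-u .v1 x + u .v3 x + P.H * dx P.L (u .w) x)
          * star (-v .v1 x + v .v3 x + P.H * dx P.L (v .w) x)
      + (P.α3 * P.h3 : ℝ) * dx P.L (u .v3) x * star (dx P.L (v .v3) x)
      - (P.γ * P.β * P.h3 : ℝ) * dx P.L (u .v3) x * star (dx P.L (v .p) x)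
      - (P.γ * P.β * P.h3 : ℝ) * dx P.L (u .p) x * star (dx P.L (v .v3) x)
      + (P.β * P.h3 : ℝ) * dx P.L (u .p) x * star (dx P.L (v .p) x))

/-- The energy norm `‖φ‖_ℋ`. -/
def energyNorm (P : Params) (φ : State) : ℝ :=
  Real.sqrt ((innerV P φ.1 φ.1).re + (innerH P φ.2 φ.2).re)

/-! ### The controlled model and the feedback -/

/-- Boundary inputs at `x = L`: the forces `g1`, `g3`, `g`, the voltage `V`, the moment `M`. -/
structure Input where
  g1 : ℂ
  g3 : ℂ
  V : ℂ
  M : ℂ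
  g : ℂ

/-- The pairing `⟨B₀ F, ψ⟩_{V', V}`, i.e. the work of the inputs `F` on a virtual displacement
`ψ`. -/
def inputWork (L : ℝ) (F : Input) (ψ : Quad) : ℂ :=
  F.g1 * star (ψ .v1 L) + F.g3 * star (ψ .v3 L) - F.V * star (ψ .p L)
    - F.M * star (dx L (ψ .w) L) + F.g * star (ψ .w L)

/-- `f` is the time derivative that the model with input `F` prescribes at the state
`φ = (z, ż) ∈ V × V`: `f = (ż, z̈)` with `z̈ ∈ H` and `M z̈ + A z = B₀ F` in `V'`. Integrating by
parts, this is the system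
`ρ₁h₁ v̈¹ - α¹h₁ v¹ₓₓ - G₂ϕ = 0`, `ρ₃h₃ v̈³ - α³h₃ v³ₓₓ + γβh₃ pₓₓ + G₂ϕ = 0`,
`μh₃ p̈ - βh₃ pₓₓ + γβh₃ v³ₓₓ = 0`, `m ẅ - K₁ ẅₓₓ + K₂ wₓₓₓₓ - G₂H ϕₓ = 0`,
`h₂ϕ = -v¹ + v³ + H wₓ`, clamped at `x = 0`, with, at `x = L`,
`α¹h₁ v¹ₓ = g¹`, `α³h₃ v³ₓ - γβh₃ pₓ = g³`, `βh₃ pₓ - γβh₃ v³ₓ = -V`, `K₂ wₓₓ = -M`,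
`K₁ ẅₓ - K₂ wₓₓₓ + G₂H ϕ = g`. -/
def IsRate (P : Params) (F : Input) (φ f : State) : Prop :=
  MemV P.L φ.1 ∧ MemV P.L φ.2 ∧ MemH P.L f.2 ∧
  (∀ c : Comp, ∀ x ∈ Icc 0 P.L, f.1 c x = φ.2 c x) ∧
  ∀ ψ : Quad, MemV P.L ψ → innerH P f.2 ψ + innerV P φ.1 ψ = inputWork P.L F ψ

/-- The feedback law `g¹ = -k₁ v̇¹(L)`, `V = k₂ ṗ(L)`, `M = k₃ ẇₓ(L)`, `g = -k₄ ẇ(L)`, with no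
force on the piezoelectric layer (`g³ = 0`). -/
def feedback (P : Params) (φ : State) : Input where
  g1 := -P.k1 * φ.2 .v1 P.L
  g3 := 0
  V := P.k2 * φ.2 .p P.L
  M := P.k3 * dx P.L (φ.2 .w) P.L
  g := -P.k4 * φ.2 .w P.L

/-- The graph of the closed-loop operator: `φ` is in its domain and is mapped to `f`. -/
def IsClosedLoop (P : Params) (φ f : State) : Prop := IsRate P (feedback P φ) φ f

/-- `φ : [0, ∞) → ℋ` is a (mild) solution of the closed-loop system: it is continuous into `ℋ`,
and its primitive `Φ(t) = ∫₀ᵗ φ(s) ds` in `ℋ` lies in the domain of the closed-loop operator and is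
mapped by it to `φ(t) - φ(0)`. -/
structure IsMildSolution (P : Params) (φ : ℝ → State) : Prop where
  mem : ∀ t, 0 ≤ t → MemE P.L (φ t)
  continuous : ∀ t₀, 0 ≤ t₀ →
    Tendsto (fun t => energyNorm P (φ t - φ t₀)) (𝓝[Ici 0] t₀) (𝓝 0)
  equation : ∃ Φ : ℝ → State, Φ 0 = 0 ∧
    (∀ t₀, 0 ≤ t₀ →
      Tendsto (fun t => energyNorm P ((t - t₀)⁻¹ • (Φ t - Φ t₀) - φ t₀))
        (𝓝[Ici 0 \ {t₀}] t₀) (𝓝 0)) ∧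
    ∀ t, 0 ≤ t → IsClosedLoop P (Φ t) (φ t - φ 0)

/-- Inertial sliding: the bending displacement `w` vanishes at all times. -/
def IsInertialSliding (P : Params) (φ : ℝ → State) : Prop :=
  ∀ t, 0 ≤ t → ∀ x ∈ Icc 0 P.L, (φ t).1 .w x = 0

/-- The overdetermined eigenvalue problem for inertial sliding motions (`w = 0`, eigenvalue
`λ = iτ`), for `v¹, v³, p ∈ H²(0, L)`. -/
structure IsSlidingEigenfunction (P : Params) (τ : ℝ) (v1 v3 p : ℝ → ℂ) : Prop where
  mem_v1 : MemH2 P.L v1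
  mem_v3 : MemH2 P.L v3
  mem_p : MemH2 P.L p
  eq_v1 : ∀ᵐ x ∂(volume.restrict (Ioo 0 P.L)),
    (P.α1 * P.h1 : ℝ) * dx P.L (dx P.L v1) x + (P.G2 / P.h2 : ℝ) * (-v1 x + v3 x)
      = -(τ ^ 2 * P.ρ1 * P.h1 : ℝ) * v1 x
  eq_v3 : ∀ᵐ x ∂(volume.restrict (Ioo 0 P.L)),
    (P.α3 * P.h3 : ℝ) * dx P.L (dx P.L v3) x - (P.γ * P.β * P.h3 : ℝ) * dx P.L (dx P.L p) x
      - (P.G2 / P.h2 : ℝ) * (-v1 x + v3 x) = -(τ ^ 2 * P.ρ3 * P.h3 : ℝ) * v3 x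
  eq_p : ∀ᵐ x ∂(volume.restrict (Ioo 0 P.L)),
    (P.β * P.h3 : ℝ) * dx P.L (dx P.L p) x - (P.γ * P.β * P.h3 : ℝ) * dx P.L (dx P.L v3) x
      = -(τ ^ 2 * P.μ * P.h3 : ℝ) * p x
  eq_w : ∀ᵐ x ∂(volume.restrict (Ioo 0 P.L)),
    (P.G2 * P.H / P.h2 : ℝ) * (-dx P.L v1 x + dx P.L v3 x) = 0
  v1_zero : v1 0 = 0
  v3_zero : v3 0 = 0
  p_zero : p 0 = 0
  dx_v1_L : dx P.L v1 P.L = 0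
  dx_v3_L : dx P.L v3 P.L = 0
  dx_p_L : dx P.L p P.L = 0
  p_L : p P.L = 0

end RaoNakra

end

/-!
Part (a) needs no semigroup theory. If there is no bending, the weak bending equation, tested with
the bending displacement whose slope is `-v¹ + v³`, says that this slope has norm zero
(`IsClosedLoop.shear_eq_zero`). So `v¹ = v³`, the core is not sheared, and what remains is a pair of
wave equations for `v¹ = v³` and `p` on the whole interval, damped at `x = L` through `v̇¹` and `ṗ`.
For this system the classical multiplier `x ∂ₓ` works. With `E` the energy norm squared,
`D = k₁ |v̇¹(L)|² + k₂ |ṗ(L)|²` and `G` the multiplier functional,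
* `E' = -2 D` (`IsClosedLoop.energy_balance`),
* `G' = (L · boundary terms - E) / 2` (`IsClosedLoop.multiplier_identity`), with boundary terms
  bounded by a multiple of `D` (`exists_boundaryTerm_le`); the undamped velocity `v̇³(L)` causes no
  loss, as it equals `v̇¹(L)`,
* `|G| ≤ C E` (`exists_abs_multiplier_le`).

Then `(t + C') E + 2 G` is nonincreasing for large `C'`, so `t E(t) ≤ C'' E(0)`
(`mul_le_of_lyapunov`). The constants depend on the parameters only. Hence the bound passes from the
increments `Φ(t + h) - Φ(t)` of the primitive `Φ` of a mild solution `φ`, which are strong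
solutions, to their limit `φ` after division by `h` (`IsMildSolution.exists_energy_decay`).

To differentiate in time, the energy is written as a weighted sum of squared `𝕃²` norms of
deformations and velocities (`strainV`, `strainH`). The regularity of the fluxes and the natural
boundary conditions come out of the weak form by the lemma of du Bois-Reymond
(`exists_hasAEDeriv_of_weak`).

For part (b), the fourth equation gives `v¹ = v³ =: v`, the first one is `v'' = -k v` with `k ≥ 0`,
and the second one turns into `p'' = d v''`, so that `p = d v`. If `d ≠ 0`, then `p(L) = 0` gives
`v(L) = 0`, and with `v'(L) = 0` the conserved quantity `|v'|² + k |v|²` vanishes. If `d = 0`, then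
`p = 0`, and the third equation is `γ v'' = 0`.
-/

open Set Filter Topology MeasureTheory

noncomputable section

namespace RaoNakra

/-! ### Absolutely continuous functions with values in `ℂ` -/

theorem _root_.LipschitzWith.comp_absolutelyContinuousOnInterval {X Y : Type*}
    [PseudoMetricSpace X] [PseudoMetricSpace Y] {g : X → Y} {K : NNReal} (hg : LipschitzWith K g)
    {f : ℝ → X} {a b : ℝ} (hf : AbsolutelyContinuousOnInterval f a b) :
    AbsolutelyContinuousOnInterval (fun x => g (f x)) a b := by
  apply squeeze_zero (fun t ↦ ?_) (fun t ↦ ?_) (by simpa using Tendsto.const_mul (K : ℝ) hf)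
  · exact Finset.sum_nonneg (fun i hi ↦ by positivity)
  · rw [Finset.mul_sum]
    gcongr
    exact hg.dist_le_mul _ _

/-- `u` is absolutely continuous on `[0, L]`, with almost everywhere derivative `u'`. -/
structure HasAEDeriv (L : ℝ) (u u' : ℝ → ℂ) : Prop where
  ac : AbsolutelyContinuousOnInterval u 0 L
  hasDerivAt : ∀ᵐ x ∂(volume.restrict (Ioo 0 L)), HasDerivAt u (u' x) x

theorem integral_zero_eq_restrict {E : Type*} [NormedAddCommGroup E] [NormedSpace ℝ E] {L : ℝ}
    (hL : 0 < L) (f : ℝ → E) : ∫ x in (0 : ℝ)..L, f x = ∫ x, f x ∂(volume.restrict (Ioo 0 L)) := by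
  rw [intervalIntegral.integral_of_le hL.le, integral_Ioc_eq_integral_Ioo]

theorem intervalIntegrable_zero_iff {L : ℝ} (hL : 0 < L) {f : ℝ → ℂ} :
    IntervalIntegrable f volume 0 L ↔ Integrable f (volume.restrict (Ioo 0 L)) := by
  rw [intervalIntegrable_iff_integrableOn_Ioo_of_le hL.le, IntegrableOn]

theorem ae_uIoc_of_ae_restrict {L : ℝ} (hL : 0 < L) {p : ℝ → Prop}
    (h : ∀ᵐ x ∂(volume.restrict (Ioo 0 L)), p x) : ∀ᵐ x, x ∈ uIoc 0 L → p x := by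
  rw [uIoc_of_le hL.le, ← ae_restrict_iff' measurableSet_Ioc, restrict_Ioo_eq_restrict_Ioc.symm]
  exact h

namespace HasAEDeriv

variable {L : ℝ} {u u' v v' : ℝ → ℂ}

theorem congr_deriv (hu : HasAEDeriv L u u') (h : u' =ᵐ[volume.restrict (Ioo 0 L)] v') :
    HasAEDeriv L u v' :=
  ⟨hu.ac, by filter_upwards [hu.hasDerivAt, h] with x h1 h2; rwa [← h2]⟩

theorem add (hu : HasAEDeriv L u u') (hv : HasAEDeriv L v v') :
    HasAEDeriv L (fun x => u x + v x) (fun x => u' x + v' x) :=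
  ⟨hu.ac.add hv.ac, by
    filter_upwards [hu.hasDerivAt, hv.hasDerivAt] with x h1 h2 using h1.add h2⟩

theorem sub (hu : HasAEDeriv L u u') (hv : HasAEDeriv L v v') :
    HasAEDeriv L (fun x => u x - v x) (fun x => u' x - v' x) :=
  ⟨hu.ac.sub hv.ac, by
    filter_upwards [hu.hasDerivAt, hv.hasDerivAt] with x h1 h2 using h1.sub h2⟩

theorem const_mul (c : ℂ) (hu : HasAEDeriv L u u') :
    HasAEDeriv L (fun x => c * u x) (fun x => c * u' x) :=
  ⟨hu.ac.const_smul c, by filter_upwards [hu.hasDerivAt] with x h1 using h1.const_mul c⟩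

theorem mul (hu : HasAEDeriv L u u') (hv : HasAEDeriv L v v') :
    HasAEDeriv L (fun x => u x * v x) (fun x => u' x * v x + u x * v' x) :=
  ⟨hu.ac.smul hv.ac, by
    filter_upwards [hu.hasDerivAt, hv.hasDerivAt] with x h1 h2 using h1.mul h2⟩

theorem conj (hu : HasAEDeriv L u u') :
    HasAEDeriv L (fun x => star (u x)) (fun x => star (u' x)) :=
  ⟨(LipschitzWith.of_dist_le_mul (K := 1) fun a b => by
      simp [dist_eq_norm, ← map_sub]).comp_absolutelyContinuousOnInterval hu.ac, by
    filter_upwards [hu.hasDerivAt] with x h1 using h1.star⟩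

theorem const (c : ℂ) : HasAEDeriv L (fun _ => c) (fun _ => 0) :=
  ⟨(contDiff_const.contDiffOn).absolutelyContinuousOnInterval, by simp [hasDerivAt_const]⟩

theorem ofReal : HasAEDeriv L (fun x => (x : ℂ)) (fun _ => 1) :=
  ⟨Complex.ofRealCLM.contDiff.contDiffOn.absolutelyContinuousOnInterval,
    .of_forall fun x => by simpa using (hasDerivAt_id x).ofReal_comp⟩

/-- The fundamental theorem of calculus for absolutely continuous functions, obtained from the
real-valued one on real and imaginary parts. -/
theorem integral_eq_sub (hL : 0 < L) (hu : HasAEDeriv L u u')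
    (hi : Integrable u' (volume.restrict (Ioo 0 L))) :
    ∫ x in (0 : ℝ)..L, u' x = u L - u 0 := by
  have key : ∀ l : ℂ →L[ℝ] ℝ, l (∫ x in (0 : ℝ)..L, u' x) = l (u L - u 0) := by
    intro l
    have h1 := (l.lipschitz.comp_absolutelyContinuousOnInterval hu.ac).integral_deriv_eq_sub
    rw [map_sub, ← h1, ← l.intervalIntegral_comp_comm ((intervalIntegrable_zero_iff hL).2 hi)]
    apply intervalIntegral.integral_congr_ae
    apply ae_uIoc_of_ae_restrict hL
    filter_upwards [hu.hasDerivAt] with x hx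
    exact ((l.hasFDerivAt.comp_hasDerivAt x hx).deriv).symm
  exact Complex.ext (key Complex.reCLM) (key Complex.imCLM)

theorem mono (hu : HasAEDeriv L u u') {y : ℝ} (hy : y ∈ Icc 0 L) : HasAEDeriv y u u' :=
  ⟨hu.ac.mono (by
      rw [uIcc_of_le hy.1, uIcc_of_le (hy.1.trans hy.2)]; exact Icc_subset_Icc le_rfl hy.2),
    ae_restrict_of_ae_restrict_of_subset (Ioo_subset_Ioo le_rfl hy.2) hu.hasDerivAt⟩

theorem eq_add_integral (hu : HasAEDeriv L u u')
    (hi : Integrable u' (volume.restrict (Ioo 0 L))) {y : ℝ} (hy : y ∈ Icc 0 L) :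
    u y = u 0 + ∫ x in (0 : ℝ)..y, u' x := by
  rcases hy.1.eq_or_lt with rfl | h
  · simp
  · rw [(hu.mono hy).integral_eq_sub h (IntegrableOn.mono_set hi (Ioo_subset_Ioo le_rfl hy.2))]
    ring

theorem eq_of_ae_zero (hu : HasAEDeriv L u u')
    (h : ∀ᵐ x ∂(volume.restrict (Ioo 0 L)), u' x = 0) {y : ℝ} (hy : y ∈ Icc 0 L) : u y = u 0 := by
  have h0 : HasAEDeriv L u (fun _ => 0) := hu.congr_deriv h
  simpa using h0.eq_add_integral (integrable_zero _ _ _) hy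

theorem continuousOn (hL : 0 < L) (hu : HasAEDeriv L u u') : ContinuousOn u (Icc 0 L) := by
  simpa [uIcc_of_le hL.le] using hu.ac.continuousOn

end HasAEDeriv

/-- The primitive of an integrable function is absolutely continuous and differentiable almost
everywhere (Lebesgue). -/
theorem hasAEDeriv_primitive {L : ℝ} (hL : 0 < L) {f : ℝ → ℂ}
    (hf : Integrable f (volume.restrict (Ioo 0 L))) :
    HasAEDeriv L (fun x => ∫ s in (0 : ℝ)..x, f s) f := by
  have hI := (intervalIntegrable_zero_iff hL).2 hf
  constructor
  · have h1 : ∀ l : ℂ →L[ℝ] ℝ,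
        AbsolutelyContinuousOnInterval (fun x => ∫ s in (0 : ℝ)..x, l (f s)) 0 L := fun l =>
      IntervalIntegrable.absolutelyContinuousOnInterval_intervalIntegral
        ((intervalIntegrable_iff.2 (l.integrable_comp (intervalIntegrable_iff.1 hI)))) left_mem_uIcc
    have h2 := (((Complex.ofRealCLM.lipschitz.comp_absolutelyContinuousOnInterval
      (h1 Complex.reCLM)).add ((Complex.ofRealCLM.lipschitz.comp_absolutelyContinuousOnInterval
      (h1 Complex.imCLM)).const_smul Complex.I)))
    -- absolute continuity on `[0, L]` only sees the values there
    refine Tendsto.congr' ?_ h2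
    filter_upwards [mem_inf_of_right (mem_principal_self _)] with E hE
    refine Finset.sum_congr rfl fun i hi => ?_
    have h3 : ∀ y ∈ uIcc 0 L, ((∫ s in (0 : ℝ)..y, (f s).re : ℝ) : ℂ)
        + Complex.I * (∫ s in (0 : ℝ)..y, (f s).im : ℝ) = ∫ s in (0 : ℝ)..y, f s := by
      intro y hy
      have hy' := hI.mono_set (uIcc_subset_uIcc left_mem_uIcc hy)
      have e1 := Complex.reCLM.intervalIntegral_comp_comm hy'
      have e2 := Complex.imCLM.intervalIntegral_comp_comm hy'
      simp only [Complex.reCLM_apply, Complex.imCLM_apply] at e1 e2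
      rw [e1, e2, mul_comm]
      exact Complex.re_add_im _
    have := hE.1 i hi
    simp only [Pi.add_apply, Complex.ofRealCLM_apply, Complex.reCLM_apply, Complex.imCLM_apply,
      smul_eq_mul]
    rw [h3 _ this.1, h3 _ this.2]
  · have h := hI.ae_hasDerivAt_integral
    filter_upwards [ae_restrict_of_ae h, ae_restrict_mem measurableSet_Ioo] with x hx hx'
    exact hx (by rw [uIcc_of_le hL.le]; exact Ioo_subset_Icc_self hx') 0 left_mem_uIcc

theorem _root_.AbsolutelyContinuousOnInterval.hasAEDeriv {L : ℝ} (hL : 0 < L) {u : ℝ → ℂ}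
    (hu : AbsolutelyContinuousOnInterval u 0 L) : HasAEDeriv L u (dx L u) := by
  refine ⟨hu, ?_⟩
  have h := hu.boundedVariationOn.ae_differentiableAt_of_mem_uIcc
  filter_upwards [ae_restrict_of_ae h, ae_restrict_mem measurableSet_Ioo] with x hx hx'
  have hd := (hx (by rw [uIcc_of_le hL.le]; exact Ioo_subset_Icc_self hx')).hasDerivAt
  rwa [dx, derivWithin_of_mem_nhds (Icc_mem_nhds hx'.1 hx'.2)]

theorem HasAEDeriv.dx_eq {L : ℝ} {u u' : ℝ → ℂ} (hu : HasAEDeriv L u u') :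
    dx L u =ᵐ[volume.restrict (Ioo 0 L)] u' := by
  filter_upwards [hu.hasDerivAt, ae_restrict_mem measurableSet_Ioo] with x hx hx'
  rw [dx, derivWithin_of_mem_nhds (Icc_mem_nhds hx'.1 hx'.2), hx.deriv]

/-! ### The Sobolev spaces on `(0, L)` -/

section Sobolev

variable {L : ℝ} {u v f g : ℝ → ℂ}

theorem MemL2.integrable (hf : MemL2 L f) : Integrable f (volume.restrict (Ioo 0 L)) :=
  MemLp.integrable one_le_two hf

theorem MemL2.sub (hf : MemL2 L f) (hg : MemL2 L g) : MemL2 L (fun x => f x - g x) :=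
  MemLp.sub hf hg

theorem MemL2.add (hf : MemL2 L f) (hg : MemL2 L g) : MemL2 L (fun x => f x + g x) :=
  MemLp.add hf hg

theorem MemL2.const_mul (c : ℂ) (hf : MemL2 L f) : MemL2 L (fun x => c * f x) :=
  MemLp.const_mul hf c

theorem MemL2.conj (hf : MemL2 L f) : MemL2 L (fun x => star (f x)) :=
  MemLp.star hf

theorem MemL2.congr (hf : MemL2 L f) (h : f =ᵐ[volume.restrict (Ioo 0 L)] g) : MemL2 L g :=
  MemLp.ae_eq h hf

theorem MemL2.integrable_mul_star (hf : MemL2 L f) (hg : MemL2 L g) :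
    Integrable (fun x => f x * star (g x)) (volume.restrict (Ioo 0 L)) :=
  MemLp.integrable_mul hf hg.conj

theorem _root_.ContinuousOn.memL2 (hf : ContinuousOn f (Icc 0 L)) : MemL2 L f := by
  obtain ⟨C, hC⟩ := isCompact_Icc.exists_bound_of_continuousOn hf
  refine MemLp.of_bound ((hf.mono Ioo_subset_Icc_self).aestronglyMeasurable measurableSet_Ioo) C ?_
  filter_upwards [ae_restrict_mem measurableSet_Ioo] with x hx
  exact hC x (Ioo_subset_Icc_self hx)

theorem MemL2.id_mul (hf : MemL2 L f) : MemL2 L (fun x => (x : ℂ) * f x) := by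
  refine MemLp.of_le_mul (c := L) hf ?_ ?_
  · exact (Complex.continuous_ofReal.aestronglyMeasurable).mul hf.aestronglyMeasurable
  · filter_upwards [ae_restrict_mem measurableSet_Ioo] with x hx
    rw [norm_mul, Complex.norm_real, Real.norm_of_nonneg hx.1.le]
    gcongr
    exact hx.2.le

theorem _root_.Set.EqOn.ae_restrict_Ioo (h : EqOn f g (Icc 0 L)) :
    f =ᵐ[volume.restrict (Ioo 0 L)] g := by
  filter_upwards [ae_restrict_mem measurableSet_Ioo] with x hx
  exact h (Ioo_subset_Icc_self hx)

theorem dx_congr (h : EqOn u v (Icc 0 L)) : EqOn (dx L u) (dx L v) (Icc 0 L) :=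
  fun _ hx => derivWithin_congr h (h hx)

theorem MemH1.hasAEDeriv (hL : 0 < L) (hu : MemH1 L u) : HasAEDeriv L u (dx L u) :=
  hu.1.hasAEDeriv hL

theorem HasAEDeriv.memH1 (hu : HasAEDeriv L u f) (hf : MemL2 L f) : MemH1 L u :=
  ⟨hu.ac, hf.congr hu.dx_eq.symm⟩

theorem MemH1.continuousOn (hL : 0 < L) (hu : MemH1 L u) : ContinuousOn u (Icc 0 L) :=
  (hu.hasAEDeriv hL).continuousOn hL

theorem MemH1.memL2 (hL : 0 < L) (hu : MemH1 L u) : MemL2 L u :=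
  (hu.continuousOn hL).memL2

theorem MemH1.congr (hL : 0 < L) (hu : MemH1 L u) (h : EqOn u v (Icc 0 L)) : MemH1 L v := by
  refine ⟨Tendsto.congr' ?_ hu.1, hu.2.congr (dx_congr h).ae_restrict_Ioo⟩
  filter_upwards [mem_inf_of_right (mem_principal_self _)] with E hE
  refine Finset.sum_congr rfl fun i hi => ?_
  have := hE.1 i hi
  rw [uIcc_of_le hL.le] at this
  rw [h this.1, h this.2]

theorem MemH1.sub (hL : 0 < L) (hu : MemH1 L u) (hv : MemH1 L v) :
    MemH1 L (fun x => u x - v x) :=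
  ((hu.hasAEDeriv hL).sub (hv.hasAEDeriv hL)).memH1 (hu.2.sub hv.2)

theorem MemH1.const_mul (hL : 0 < L) (c : ℂ) (hu : MemH1 L u) : MemH1 L (fun x => c * u x) :=
  ((hu.hasAEDeriv hL).const_mul c).memH1 (hu.2.const_mul c)

theorem MemH1.dx_sub (hL : 0 < L) (hu : MemH1 L u) (hv : MemH1 L v) :
    dx L (fun x => u x - v x) =ᵐ[volume.restrict (Ioo 0 L)] fun x => dx L u x - dx L v x :=
  ((hu.hasAEDeriv hL).sub (hv.hasAEDeriv hL)).dx_eq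

theorem MemH1.dx_const_mul (hL : 0 < L) (c : ℂ) (hu : MemH1 L u) :
    dx L (fun x => c * u x) =ᵐ[volume.restrict (Ioo 0 L)] fun x => c * dx L u x :=
  ((hu.hasAEDeriv hL).const_mul c).dx_eq

theorem MemH2.dx_sub (hL : 0 < L) (hu : MemH2 L u) (hv : MemH2 L v) :
    EqOn (dx L (fun x => u x - v x)) (fun x => dx L u x - dx L v x) (Icc 0 L) := fun x hx =>
  ((hu.1 x hx).hasDerivWithinAt.sub (hv.1 x hx).hasDerivWithinAt).derivWithin
    (uniqueDiffOn_Icc hL x hx)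

theorem MemH2.dx_const_mul (hL : 0 < L) (c : ℂ) (hu : MemH2 L u) :
    EqOn (dx L (fun x => c * u x)) (fun x => c * dx L u x) (Icc 0 L) := fun x hx =>
  ((hu.1 x hx).hasDerivWithinAt.const_mul c).derivWithin (uniqueDiffOn_Icc hL x hx)

theorem MemH2.sub (hL : 0 < L) (hu : MemH2 L u) (hv : MemH2 L v) :
    MemH2 L (fun x => u x - v x) :=
  ⟨hu.1.sub hv.1, (hu.2.sub hL hv.2).congr hL (hu.dx_sub hL hv).symm⟩

theorem MemH2.const_mul (hL : 0 < L) (c : ℂ) (hu : MemH2 L u) : MemH2 L (fun x => c * u x) :=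
  ⟨hu.1.const_mul c, (hu.2.const_mul hL c).congr hL (hu.dx_const_mul hL c).symm⟩

theorem MemH2.dx_dx_sub (hL : 0 < L) (hu : MemH2 L u) (hv : MemH2 L v) :
    dx L (dx L (fun x => u x - v x)) =ᵐ[volume.restrict (Ioo 0 L)]
      fun x => dx L (dx L u) x - dx L (dx L v) x :=
  (dx_congr (hu.dx_sub hL hv)).ae_restrict_Ioo.trans (hu.2.dx_sub hL hv.2)

theorem MemH2.dx_dx_const_mul (hL : 0 < L) (c : ℂ) (hu : MemH2 L u) :
    dx L (dx L (fun x => c * u x)) =ᵐ[volume.restrict (Ioo 0 L)]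
      fun x => c * dx L (dx L u) x :=
  (dx_congr (hu.dx_const_mul hL c)).ae_restrict_Ioo.trans (hu.2.dx_const_mul hL c)

theorem MemH2.memH1 (hL : 0 < L) (hu : MemH2 L u) : MemH1 L u := by
  have hc : ContinuousOn (dx L u) (Icc 0 L) := hu.2.continuousOn hL
  refine ⟨?_, hc.memL2⟩
  obtain ⟨C, hC⟩ := isCompact_Icc.exists_bound_of_continuousOn hc
  refine LipschitzOnWith.absolutelyContinuousOnInterval (K := C.toNNReal) ?_
  rw [uIcc_of_le hL.le]
  refine (convex_Icc 0 L).lipschitzOnWith_of_nnnorm_derivWithin_le hu.1 fun x hx => ?_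
  exact NNReal.le_toNNReal_of_coe_le (hC x hx)

theorem MemH2.hasAEDeriv (hL : 0 < L) (hu : MemH2 L u) : HasAEDeriv L u (dx L u) :=
  (hu.memH1 hL).hasAEDeriv hL

theorem MemH1L.sub (hL : 0 < L) (hu : MemH1L L u) (hv : MemH1L L v) :
    MemH1L L (fun x => u x - v x) :=
  ⟨hu.1.sub hL hv.1, by simp [hu.2, hv.2]⟩

theorem MemH1L.const_mul (hL : 0 < L) (c : ℂ) (hu : MemH1L L u) : MemH1L L (fun x => c * u x) :=
  ⟨hu.1.const_mul hL c, by simp [hu.2]⟩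

theorem MemH2L.sub (hL : 0 < L) (hu : MemH2L L u) (hv : MemH2L L v) :
    MemH2L L (fun x => u x - v x) :=
  ⟨hu.1.sub hL hv.1, by simp [hu.2.1, hv.2.1], by
    rw [hu.1.dx_sub hL hv.1 (left_mem_Icc.2 hL.le)]; simp [hu.2.2, hv.2.2]⟩

theorem MemH2L.const_mul (hL : 0 < L) (c : ℂ) (hu : MemH2L L u) : MemH2L L (fun x => c * u x) :=
  ⟨hu.1.const_mul hL c, by simp [hu.2.1], by
    rw [hu.1.dx_const_mul hL c (left_mem_Icc.2 hL.le)]; simp [hu.2.2]⟩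

theorem MemH2L.memH1L (hL : 0 < L) (hu : MemH2L L u) : MemH1L L u := ⟨hu.1.memH1 hL, hu.2.1⟩

theorem memH1L_primitive (hL : 0 < L) (hf : MemL2 L f) :
    MemH1L L (fun x => ∫ s in (0 : ℝ)..x, f s) :=
  ⟨(hasAEDeriv_primitive hL hf.integrable).memH1 hf, by simp⟩

theorem hasDerivWithinAt_primitive (hL : 0 < L) (hf : ContinuousOn f (Icc 0 L)) {x : ℝ}
    (hx : x ∈ Icc 0 L) :
    HasDerivWithinAt (fun x => ∫ s in (0 : ℝ)..x, f s) (f x) (Icc 0 L) x := by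
  -- replace `f` by its continuous extension by constants
  have hg : Continuous (IccExtend hL.le ((Icc 0 L).domRestrict f)) :=
    (continuousOn_iff_continuous_domRestrict.1 hf).Icc_extend'
  have hfg : ∀ y ∈ Icc 0 L, IccExtend hL.le ((Icc 0 L).domRestrict f) y = f y := fun y hy => by
    rw [IccExtend_of_mem _ _ hy]; rfl
  have h := (hg.integral_hasStrictDerivAt 0 x).hasDerivAt.hasDerivWithinAt (s := Icc 0 L)
  rw [hfg x hx] at h
  refine h.congr_of_mem (fun y hy => ?_) hx
  refine intervalIntegral.integral_congr fun s hs => (hfg s ?_).symm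
  rw [uIcc_of_le hy.1] at hs
  exact ⟨hs.1, hs.2.trans hy.2⟩

theorem dx_primitive (hL : 0 < L) (hf : ContinuousOn f (Icc 0 L)) :
    EqOn (dx L fun x => ∫ s in (0 : ℝ)..x, f s) f (Icc 0 L) := fun x hx =>
  (hasDerivWithinAt_primitive hL hf hx).derivWithin (uniqueDiffOn_Icc hL x hx)

theorem memH2L_primitive (hL : 0 < L) (hf : MemH1L L f) :
    MemH2L L (fun x => ∫ s in (0 : ℝ)..x, f s) := by
  have hc := hf.1.continuousOn hL
  refine ⟨⟨fun x hx => (hasDerivWithinAt_primitive hL hc hx).differentiableWithinAt,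
    hf.1.congr hL (dx_primitive hL hc).symm⟩, by simp, ?_⟩
  rw [dx_primitive hL hc (left_mem_Icc.2 hL.le), hf.2]

theorem _root_.ContinuousOn.eq_zero_of_ae (hf : ContinuousOn f (Icc 0 L)) (hL : 0 < L)
    (h : ∀ᵐ x ∂(volume.restrict (Ioo 0 L)), f x = 0) {x : ℝ} (hx : x ∈ Icc 0 L) : f x = 0 := by
  have hI := dx_primitive hL hf hx
  rw [← hI]
  have h0 : EqOn (fun x => ∫ s in (0 : ℝ)..x, f s) (fun _ => (0 : ℂ)) (Icc 0 L) := by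
    intro y hy
    have := (hasAEDeriv_primitive hL hf.memL2.integrable).eq_of_ae_zero h hy
    simpa using this
  rw [dx_congr h0 hx]
  simp [dx]

end Sobolev

/-! ### Classes in `𝕃²(0, L)` -/

/-- The Hilbert space `𝕃²(0, L)`. -/
abbrev L2 (L : ℝ) : Type := Lp ℂ 2 (volume.restrict (Ioo (0 : ℝ) L))

/-- The class of `f` in `𝕃²(0, L)`, with value `0` when `f` is not square integrable. -/
def cls (L : ℝ) (f : ℝ → ℂ) : L2 L := open Classical in
  if h : MemL2 L f then MemLp.toLp f h else 0

section cls

variable {L : ℝ} {f g : ℝ → ℂ}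

theorem MemL2.cls_eq (hf : MemL2 L f) : cls L f = MemLp.toLp f hf := dif_pos hf

theorem MemL2.coe_cls (hf : MemL2 L f) : cls L f =ᵐ[volume.restrict (Ioo 0 L)] f := by
  rw [hf.cls_eq]; exact MemLp.coeFn_toLp hf

theorem cls_congr (h : f =ᵐ[volume.restrict (Ioo 0 L)] g) : cls L f = cls L g := by
  by_cases hf : MemL2 L f
  · rw [hf.cls_eq, (hf.congr h).cls_eq]; exact MemLp.toLp_congr _ _ h
  · have hg : ¬ MemL2 L g := fun hg => hf (hg.congr h.symm)
    rw [cls, cls, dif_neg hf, dif_neg hg]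

theorem MemL2.cls_sub (hf : MemL2 L f) (hg : MemL2 L g) :
    cls L (fun x => f x - g x) = cls L f - cls L g := by
  rw [hf.cls_eq, hg.cls_eq, (hf.sub hg).cls_eq]; rfl

theorem MemL2.cls_add (hf : MemL2 L f) (hg : MemL2 L g) :
    cls L (fun x => f x + g x) = cls L f + cls L g := by
  rw [hf.cls_eq, hg.cls_eq, (hf.add hg).cls_eq]; rfl

theorem MemL2.cls_const_mul (c : ℂ) (hf : MemL2 L f) :
    cls L (fun x => c * f x) = c • cls L f := by
  rw [hf.cls_eq, (hf.const_mul c).cls_eq]; rfl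

theorem cls_zero : cls L (fun _ => 0) = 0 := by
  have h : MemL2 L (fun _ => 0) := MemLp.zero
  rw [h.cls_eq]; rfl

theorem MemL2.ae_zero_of_cls (hf : MemL2 L f) (h : cls L f = 0) :
    ∀ᵐ x ∂(volume.restrict (Ioo 0 L)), f x = 0 := by
  have h1 := hf.coe_cls
  rw [h] at h1
  filter_upwards [h1, Lp.coeFn_zero ℂ 2 (volume.restrict (Ioo 0 L))] with x h2 h3
  rw [← h2, h3]; rfl

theorem MemL2.inner_cls (hL : 0 < L) (hf : MemL2 L f) (hg : MemL2 L g) :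
    inner ℂ (cls L f) (cls L g) = ∫ x in (0 : ℝ)..L, g x * star (f x) := by
  rw [L2.inner_def, integral_zero_eq_restrict hL]
  refine integral_congr_ae ?_
  filter_upwards [hf.coe_cls, hg.coe_cls] with x h1 h2
  rw [h1, h2]; rfl

/-- Multiplication by the space variable `x`, as a bounded operator on `𝕃²(0, L)`. -/
def mulId (L : ℝ) : L2 L →L[ℂ] L2 L :=
  LinearMap.mkContinuous
    { toFun := fun f => cls L (fun x => (x : ℂ) * f x)
      map_add' := fun f g => by
        have hf : MemL2 L f := Lp.memLp f
        have hg : MemL2 L g := Lp.memLp g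
        rw [← hf.id_mul.cls_add hg.id_mul]
        refine cls_congr ?_
        filter_upwards [Lp.coeFn_add f g] with x hx
        rw [hx, Pi.add_apply, mul_add]
      map_smul' := fun c f => by
        have hf : MemL2 L f := Lp.memLp f
        rw [RingHom.id_apply, ← hf.id_mul.cls_const_mul c]
        refine cls_congr ?_
        filter_upwards [Lp.coeFn_smul c f] with x hx
        rw [hx, Pi.smul_apply, smul_eq_mul, mul_left_comm] } L
    fun f => by
      have hf : MemL2 L f := Lp.memLp f
      refine Lp.norm_le_mul_norm_of_ae_le_mul ?_
      filter_upwards [hf.id_mul.coe_cls, ae_restrict_mem measurableSet_Ioo] with x hx hx'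
      change ‖cls L _ x‖ ≤ _
      rw [hx, norm_mul, Complex.norm_real, Real.norm_of_nonneg hx'.1.le]
      gcongr
      exact hx'.2.le

theorem norm_mulId_le (hL : 0 < L) (f : L2 L) : ‖mulId L f‖ ≤ L * ‖f‖ :=
  (mulId L).le_of_opNorm_le (LinearMap.mkContinuous_norm_le _ hL.le _) f

theorem MemL2.mulId_cls (hf : MemL2 L f) :
    mulId L (cls L f) = cls L (fun x => (x : ℂ) * f x) := by
  refine cls_congr ?_
  filter_upwards [hf.coe_cls] with x hx
  rw [hx]

end cls

/-! ### Integration by parts -/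

section Parts

variable {L : ℝ} {u u' v v' : ℝ → ℂ}

theorem HasAEDeriv.memL2 (hL : 0 < L) (hu : HasAEDeriv L u u') : MemL2 L u :=
  (hu.continuousOn hL).memL2

theorem HasAEDeriv.integral_parts (hL : 0 < L) (hu : HasAEDeriv L u u') (hu' : MemL2 L u')
    (hv : HasAEDeriv L v v') (hv' : MemL2 L v') :
    ∫ x in (0 : ℝ)..L, (u' x * star (v x) + u x * star (v' x)) =
      u L * star (v L) - u 0 * star (v 0) :=
  (hu.mul hv.conj).integral_eq_sub hL
    ((hu'.integrable_mul_star (hv.memL2 hL)).add ((hu.memL2 hL).integrable_mul_star hv'))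

/-- Integration by parts against the multiplier `x`. -/
theorem HasAEDeriv.integral_id_mul_parts (hL : 0 < L) (hu : HasAEDeriv L u u')
    (hu' : MemL2 L u') (hv : HasAEDeriv L v v') (hv' : MemL2 L v') :
    (∫ x in (0 : ℝ)..L, u' x * star ((x : ℂ) * v x)) +
        ∫ x in (0 : ℝ)..L, u x * star ((x : ℂ) * v' x) =
      L * (u L * star (v L)) - ∫ x in (0 : ℝ)..L, u x * star (v x) := by
  have h := hu.integral_parts hL hu' (HasAEDeriv.ofReal.mul hv)
    (((hv.memL2 hL).const_mul 1).add hv'.id_mul)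
  have i1 := hu'.integrable_mul_star (hv.memL2 hL).id_mul
  have i2 := (hu.memL2 hL).integrable_mul_star (hv.memL2 hL)
  have i3 := (hu.memL2 hL).integrable_mul_star hv'.id_mul
  rw [integral_zero_eq_restrict hL] at h ⊢
  rw [integral_zero_eq_restrict hL, integral_zero_eq_restrict hL, ← integral_add i1 i3,
    eq_sub_iff_add_eq]
  have j := integral_add (i1.add i3) i2
  simp only [Pi.add_apply] at j
  have e : (fun x : ℝ => u' x * star ((x : ℂ) * v x) + u x * star (1 * v x + (x : ℂ) * v' x))
      = fun x => u' x * star ((x : ℂ) * v x) + u x * star ((x : ℂ) * v' x)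
        + u x * star (v x) := by
    funext x; simp only [star_add, star_mul', star_one]; ring
  rw [e] at h
  rw [← j, h]
  simp only [star_mul', Complex.ofReal_zero, zero_mul, mul_zero, sub_zero, star_zero,
    Complex.star_def, Complex.conj_ofReal]
  ring

/-- Du Bois-Reymond: a weak form tested on all of `H¹_L` gives the regularity of the flux `a`,
its derivative, and the natural boundary condition at `x = L`. -/
theorem exists_hasAEDeriv_of_weak (hL : 0 < L) {f a : ℝ → ℂ} (hf : MemL2 L f) (ha : MemL2 L a)
    (c : ℂ) (h : ∀ ψ, MemH1L L ψ →
      (∫ x in (0 : ℝ)..L, f x * star (ψ x)) + ∫ x in (0 : ℝ)..L, a x * star (dx L ψ x)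
        = c * star (ψ L)) :
    ∃ A : ℝ → ℂ, HasAEDeriv L A f ∧ A L = c ∧ a =ᵐ[volume.restrict (Ioo 0 L)] A := by
  set A : ℝ → ℂ := fun x => (∫ s in (0 : ℝ)..x, f s) + (c - ∫ s in (0 : ℝ)..L, f s) with hA
  have hAf : HasAEDeriv L A f := by
    simpa using (hasAEDeriv_primitive hL hf.integrable).add
      (HasAEDeriv.const (c - ∫ s in (0 : ℝ)..L, f s))
  have hAL : A L = c := by simp [hA]
  have hA2 := hAf.memL2 hL
  have hd := ha.sub hA2
  refine ⟨A, hAf, hAL, ?_⟩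
  -- test with the primitive of `a - A`
  set ψ : ℝ → ℂ := fun x => ∫ s in (0 : ℝ)..x, (a s - A s) with hψ
  have hψ1 : MemH1L L ψ := memH1L_primitive hL hd
  have hψd : dx L ψ =ᵐ[volume.restrict (Ioo 0 L)] fun x => a x - A x :=
    (hasAEDeriv_primitive hL hd.integrable).dx_eq
  have e1 := h ψ hψ1
  have e2 := hAf.integral_parts hL hf (hψ1.1.hasAEDeriv hL) hψ1.1.2
  have hψL2 := hψ1.1.memL2 hL
  rw [hψ1.2, star_zero, mul_zero, sub_zero, hAL, integral_zero_eq_restrict hL,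
    integral_add (hf.integrable_mul_star hψL2) (hA2.integrable_mul_star hψ1.1.2), ← e1,
    integral_zero_eq_restrict hL, integral_zero_eq_restrict hL] at e2
  have e3 := add_left_cancel e2
  have e4 : inner ℂ (cls L fun x => a x - A x) (cls L fun x => a x - A x) = (0 : ℂ) := by
    rw [hd.inner_cls hL hd, integral_zero_eq_restrict hL]
    rw [eq_comm, ← sub_eq_zero, ← integral_sub (ha.integrable_mul_star hψ1.1.2)
      (hA2.integrable_mul_star hψ1.1.2)] at e3
    rw [← e3]
    refine integral_congr_ae ?_
    filter_upwards [hψd] with x hx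
    rw [hx]; ring
  filter_upwards [hd.ae_zero_of_cls (inner_self_eq_zero.1 e4)] with x hx
  exact sub_eq_zero.1 hx

end Parts

/-! ### The energy as a weighted sum of squares -/

/-- The five deformations that carry the potential energy. The last two diagonalize the
piezoelectric part: `α³|a|² - 2γβ Re(a b̄) + β|b|² = α₁³|a|² + β|b - γa|²`. -/
def strainV (P : Params) (z : Quad) : Fin 5 → ℝ → ℂ :=
  ![dx P.L (z .v1), dx P.L (dx P.L (z .w)),
    fun x => -z .v1 x + z .v3 x + P.H * dx P.L (z .w) x,
    dx P.L (z .v3), fun x => dx P.L (z .p) x - P.γ * dx P.L (z .v3) x]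

/-- The stiffnesses belonging to `strainV`. -/
def weightV (P : Params) : Fin 5 → ℝ :=
  ![P.α1 * P.h1, P.K2, P.G2 / P.h2, P.α31 * P.h3, P.β * P.h3]

/-- The five velocities that carry the kinetic energy. -/
def strainH (P : Params) (z : Quad) : Fin 5 → ℝ → ℂ :=
  ![z .v1, z .v3, z .p, z .w, dx P.L (z .w)]

/-- The inertias belonging to `strainH`. -/
def weightH (P : Params) : Fin 5 → ℝ :=
  ![P.ρ1 * P.h1, P.ρ3 * P.h3, P.μ * P.h3, P.m, P.K1]

/-- The classes of `strainV` in `𝕃²`. -/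
def eV (P : Params) (z : Quad) (i : Fin 5) : L2 P.L := cls P.L (strainV P z i)

/-- The classes of `strainH` in `𝕃²`. -/
def eH (P : Params) (z : Quad) (i : Fin 5) : L2 P.L := cls P.L (strainH P z i)

/-- The square of the energy norm, written with the classes `eV`, `eH`. -/
def energy (P : Params) (φ : State) : ℝ :=
  ∑ i, weightV P i * ‖eV P φ.1 i‖ ^ 2 + ∑ i, weightH P i * ‖eH P φ.2 i‖ ^ 2

theorem Params.m_pos (P : Params) : 0 < P.m := by
  have := mul_pos P.ρ1_pos P.h1_pos
  have := mul_nonneg P.ρ2_nonneg P.h2_pos.le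
  have := mul_pos P.ρ3_pos P.h3_pos
  unfold Params.m; linarith

theorem Params.H_pos (P : Params) : 0 < P.H := by
  have := P.h1_pos; have := P.h2_pos; have := P.h3_pos
  unfold Params.H; linarith

theorem Params.α3_pos (P : Params) : 0 < P.α3 := by
  have := mul_nonneg (sq_nonneg P.γ) P.β_pos.le
  have := P.α31_pos
  unfold Params.α3; linarith

theorem weightV_pos (P : Params) (i : Fin 5) : 0 < weightV P i := by
  have := P.α1_pos; have := P.h1_pos; have := P.h2_pos; have := P.h3_pos; have := P.α31_pos
  have := P.β_pos; have := P.G2_pos; have := P.α3_pos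
  fin_cases i <;> simp [weightV, Params.K2] <;> positivity

theorem weightH_pos (P : Params) (i : Fin 5) : 0 < weightH P i := by
  have := P.ρ1_pos; have := P.h1_pos; have := P.ρ3_pos; have := P.h3_pos; have := P.μ_pos
  have := P.m_pos
  fin_cases i <;> simp [weightH, Params.K1] <;> positivity

theorem energy_nonneg (P : Params) (φ : State) : 0 ≤ energy P φ :=
  add_nonneg
    (Finset.sum_nonneg fun i _ => mul_nonneg (weightV_pos P i).le (sq_nonneg _))
    (Finset.sum_nonneg fun i _ => mul_nonneg (weightH_pos P i).le (sq_nonneg _))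

theorem eV_sq_le_energy (P : Params) (φ : State) (i : Fin 5) :
    weightV P i * ‖eV P φ.1 i‖ ^ 2 ≤ energy P φ := by
  have h1 : weightV P i * ‖eV P φ.1 i‖ ^ 2 ≤ ∑ i, weightV P i * ‖eV P φ.1 i‖ ^ 2 :=
    Finset.single_le_sum (f := fun i => weightV P i * ‖eV P φ.1 i‖ ^ 2)
      (fun i _ => mul_nonneg (weightV_pos P i).le (sq_nonneg _)) (Finset.mem_univ i)
  refine h1.trans (le_add_of_nonneg_right ?_)
  exact Finset.sum_nonneg fun i _ => mul_nonneg (weightH_pos P i).le (sq_nonneg _)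

theorem eH_sq_le_energy (P : Params) (φ : State) (i : Fin 5) :
    weightH P i * ‖eH P φ.2 i‖ ^ 2 ≤ energy P φ := by
  have h1 : weightH P i * ‖eH P φ.2 i‖ ^ 2 ≤ ∑ i, weightH P i * ‖eH P φ.2 i‖ ^ 2 :=
    Finset.single_le_sum (f := fun i => weightH P i * ‖eH P φ.2 i‖ ^ 2)
      (fun i _ => mul_nonneg (weightH_pos P i).le (sq_nonneg _)) (Finset.mem_univ i)
  refine h1.trans (le_add_of_nonneg_left ?_)
  exact Finset.sum_nonneg fun i _ => mul_nonneg (weightV_pos P i).le (sq_nonneg _)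

section Spaces

variable {P : Params} {z y : Quad}

theorem MemV.sub (hz : MemV P.L z) (hy : MemV P.L y) : MemV P.L (z - y) :=
  ⟨hz.1.sub P.L_pos hy.1, hz.2.1.sub P.L_pos hy.2.1, hz.2.2.1.sub P.L_pos hy.2.2.1,
    hz.2.2.2.sub P.L_pos hy.2.2.2⟩

theorem MemV.smul (r : ℝ) (hz : MemV P.L z) : MemV P.L (r • z) :=
  ⟨hz.1.const_mul P.L_pos r, hz.2.1.const_mul P.L_pos r, hz.2.2.1.const_mul P.L_pos r,
    hz.2.2.2.const_mul P.L_pos r⟩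

theorem MemH.sub (hz : MemH P.L z) (hy : MemH P.L y) : MemH P.L (z - y) :=
  ⟨MemL2.sub hz.1 hy.1, MemL2.sub hz.2.1 hy.2.1, MemL2.sub hz.2.2.1 hy.2.2.1,
    hz.2.2.2.sub P.L_pos hy.2.2.2⟩

theorem MemH.smul (r : ℝ) (hz : MemH P.L z) : MemH P.L (r • z) :=
  ⟨MemL2.const_mul r hz.1, MemL2.const_mul r hz.2.1, MemL2.const_mul r hz.2.2.1,
    hz.2.2.2.const_mul P.L_pos r⟩

theorem MemV.memH (hz : MemV P.L z) : MemH P.L z :=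
  ⟨hz.1.1.memL2 P.L_pos, hz.2.1.1.memL2 P.L_pos, hz.2.2.1.1.memL2 P.L_pos,
    hz.2.2.2.memH1L P.L_pos⟩

theorem MemE.sub {φ χ : State} (hφ : MemE P.L φ) (hχ : MemE P.L χ) : MemE P.L (φ - χ) :=
  ⟨MemV.sub hφ.1 hχ.1, MemH.sub hφ.2 hχ.2⟩

theorem MemE.smul {φ : State} (r : ℝ) (hφ : MemE P.L φ) : MemE P.L (r • φ) :=
  ⟨MemV.smul r hφ.1, MemH.smul r hφ.2⟩

theorem MemV.memL2_strainV (hz : MemV P.L z) (i : Fin 5) : MemL2 P.L (strainV P z i) := by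
  obtain ⟨h1, h3, hp, hw⟩ := hz
  fin_cases i
  · exact h1.1.2
  · exact hw.1.2.2
  · have := (((h3.1.memL2 P.L_pos).sub (h1.1.memL2 P.L_pos)).add
      ((hw.1.2.memL2 P.L_pos).const_mul P.H))
    refine MemL2.congr this (.of_forall fun x => ?_)
    change z .v3 x - z .v1 x + _ = -z .v1 x + z .v3 x + _
    ring
  · exact h3.1.2
  · exact hp.1.2.sub (h3.1.2.const_mul P.γ)

theorem MemH.memL2_strainH (hz : MemH P.L z) (i : Fin 5) : MemL2 P.L (strainH P z i) := by
  obtain ⟨h1, h3, hp, hw⟩ := hz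
  fin_cases i
  · exact h1
  · exact h3
  · exact hp
  · exact hw.1.memL2 P.L_pos
  · exact hw.1.2

theorem eV_sub (hz : MemV P.L z) (hy : MemV P.L y) (i : Fin 5) :
    eV P (z - y) i = eV P z i - eV P y i := by
  rw [eV, eV, eV, ← (hz.memL2_strainV i).cls_sub (hy.memL2_strainV i)]
  apply cls_congr
  obtain ⟨h1, h3, hp, hw⟩ := hz
  obtain ⟨h1', h3', hp', hw'⟩ := hy
  fin_cases i
  · exact h1.1.dx_sub P.L_pos h1'.1
  · exact hw.1.dx_dx_sub P.L_pos hw'.1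
  · filter_upwards [(hw.1.dx_sub P.L_pos hw'.1).ae_restrict_Ioo] with x hx
    change -(z .v1 x - y .v1 x) + (z .v3 x - y .v3 x) + P.H * dx P.L (fun x => z .w x - y .w x) x
      = (-z .v1 x + z .v3 x + P.H * dx P.L (z .w) x)
        - (-y .v1 x + y .v3 x + P.H * dx P.L (y .w) x)
    rw [hx]; ring
  · exact h3.1.dx_sub P.L_pos h3'.1
  · filter_upwards [hp.1.dx_sub P.L_pos hp'.1, h3.1.dx_sub P.L_pos h3'.1] with x hx hx'
    change dx P.L (fun x => z .p x - y .p x) x - P.γ * dx P.L (fun x => z .v3 x - y .v3 x) x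
      = (dx P.L (z .p) x - P.γ * dx P.L (z .v3) x) - (dx P.L (y .p) x - P.γ * dx P.L (y .v3) x)
    rw [hx, hx']; ring

theorem eV_smul (r : ℝ) (hz : MemV P.L z) (i : Fin 5) :
    eV P (r • z) i = (r : ℂ) • eV P z i := by
  rw [eV, eV, ← (hz.memL2_strainV i).cls_const_mul r]
  apply cls_congr
  obtain ⟨h1, h3, hp, hw⟩ := hz
  fin_cases i
  · exact h1.1.dx_const_mul P.L_pos r
  · exact hw.1.dx_dx_const_mul P.L_pos r
  · filter_upwards [(hw.1.dx_const_mul P.L_pos r).ae_restrict_Ioo] with x hx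
    change -(r * z .v1 x) + (r * z .v3 x) + P.H * dx P.L (fun x => r * z .w x) x
      = r * (-z .v1 x + z .v3 x + P.H * dx P.L (z .w) x)
    rw [hx]; ring
  · exact h3.1.dx_const_mul P.L_pos r
  · filter_upwards [hp.1.dx_const_mul P.L_pos r, h3.1.dx_const_mul P.L_pos r] with x hx hx'
    change dx P.L (fun x => r * z .p x) x - P.γ * dx P.L (fun x => r * z .v3 x) x
      = r * (dx P.L (z .p) x - P.γ * dx P.L (z .v3) x)
    rw [hx, hx']; ring

theorem eH_sub (hz : MemH P.L z) (hy : MemH P.L y) (i : Fin 5) :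
    eH P (z - y) i = eH P z i - eH P y i := by
  rw [eH, eH, eH, ← (hz.memL2_strainH i).cls_sub (hy.memL2_strainH i)]
  apply cls_congr
  fin_cases i
  · rfl
  · rfl
  · rfl
  · rfl
  · exact hz.2.2.2.1.dx_sub P.L_pos hy.2.2.2.1

theorem eH_smul (r : ℝ) (hz : MemH P.L z) (i : Fin 5) :
    eH P (r • z) i = (r : ℂ) • eH P z i := by
  rw [eH, eH, ← (hz.memL2_strainH i).cls_const_mul r]
  apply cls_congr
  fin_cases i
  · rfl
  · rfl
  · rfl
  · rfl
  · exact hz.2.2.2.1.dx_const_mul P.L_pos r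

/-- Displacements that agree on `[0, L]` have the same deformations. -/
theorem eV_congr (h : ∀ c, ∀ x ∈ Icc 0 P.L, z c x = y c x) (i : Fin 5) : eV P z i = eV P y i := by
  apply cls_congr
  apply EqOn.ae_restrict_Ioo
  have hd : ∀ c, EqOn (dx P.L (z c)) (dx P.L (y c)) (Icc 0 P.L) := fun c => dx_congr (h c)
  fin_cases i
  · exact hd .v1
  · exact dx_congr (hd .w)
  · intro x hx
    simp [strainV, h _ x hx, hd .w hx]
  · exact hd .v3
  · intro x hx
    simp [strainV, hd _ hx]

theorem sum_mul_inner_cls {L : ℝ} (hL : 0 < L) {ι : Type*} [Fintype ι] (c : ι → ℝ)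
    {s t : ι → ℝ → ℂ} (hs : ∀ i, MemL2 L (s i)) (ht : ∀ i, MemL2 L (t i)) :
    ∑ i, (c i : ℂ) * inner ℂ (cls L (t i)) (cls L (s i))
      = ∫ x in (0 : ℝ)..L, ∑ i, (c i : ℂ) * (s i x * star (t i x)) := by
  rw [integral_zero_eq_restrict hL, integral_finsetSum]
  · refine Finset.sum_congr rfl fun i _ => ?_
    rw [(ht i).inner_cls hL (hs i), integral_const_mul, integral_zero_eq_restrict hL]
  · exact fun i _ => ((hs i).integrable_mul_star (ht i)).const_mul _

theorem innerV_eq (hz : MemV P.L z) (hy : MemV P.L y) :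
    innerV P z y = ∑ i, (weightV P i : ℂ) * inner ℂ (eV P y i) (eV P z i) := by
  simp only [eV]
  rw [sum_mul_inner_cls P.L_pos _ hz.memL2_strainV hy.memL2_strainV, innerV]
  congr 1
  funext x
  simp only [Fin.sum_univ_five, weightV, strainV, Matrix.cons_val, Complex.star_def, map_sub,
    map_add, map_mul, map_neg, Params.α3, Complex.conj_ofReal]
  push_cast
  ring

theorem innerH_eq (hz : MemH P.L z) (hy : MemH P.L y) :
    innerH P z y = ∑ i, (weightH P i : ℂ) * inner ℂ (eH P y i) (eH P z i) := by
  simp only [eH]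
  rw [sum_mul_inner_cls P.L_pos _ hz.memL2_strainH hy.memL2_strainH, innerH]
  congr 1
  funext x
  simp only [Fin.sum_univ_five, weightH, strainH, Matrix.cons_val]
  push_cast
  ring

theorem energyNorm_sq {φ : State} (hφ : MemE P.L φ) : energyNorm P φ ^ 2 = energy P φ := by
  have h : (innerV P φ.1 φ.1).re + (innerH P φ.2 φ.2).re = energy P φ := by
    rw [innerV_eq hφ.1 hφ.1, innerH_eq hφ.2 hφ.2, energy, Complex.re_sum, Complex.re_sum]
    congr 1 <;>
    · refine Finset.sum_congr rfl fun i _ => ?_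
      rw [inner_self_eq_norm_sq_to_K, Complex.re_ofReal_mul]
      norm_cast
  rw [energyNorm, h, Real.sq_sqrt (energy_nonneg P φ)]

/-- Convergence in the energy norm is convergence of all deformations and velocities in `𝕃²`. -/
theorem tendsto_eV_of_energyNorm {ι : Type*} {l : Filter ι} {φ : ι → State}
    (hm : ∀ᶠ t in l, MemE P.L (φ t)) (h : Tendsto (fun t => energyNorm P (φ t)) l (𝓝 0))
    (i : Fin 5) : Tendsto (fun t => eV P (φ t).1 i) l (𝓝 0) ∧
      Tendsto (fun t => eH P (φ t).2 i) l (𝓝 0) := by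
  have h2 : Tendsto (fun t => energy P (φ t)) l (𝓝 0) := by
    have := h.pow 2
    rw [zero_pow two_ne_zero] at this
    exact this.congr' (hm.mono fun t ht => energyNorm_sq ht)
  have aux : ∀ (w : ℝ) (_ : 0 < w) (e : ι → L2 P.L), (∀ t, w * ‖e t‖ ^ 2 ≤ energy P (φ t)) →
      Tendsto e l (𝓝 0) := by
    intro w hw e he
    rw [tendsto_zero_iff_norm_tendsto_zero]
    have h3 : Tendsto (fun t => ‖e t‖ ^ 2) l (𝓝 0) := by
      refine squeeze_zero (fun t => sq_nonneg _) (fun t => ?_)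
        (by simpa using h2.const_mul w⁻¹)
      rw [← div_eq_inv_mul, le_div_iff₀ hw, mul_comm]
      exact he t
    have h4 := h3.sqrt
    simpa using h4
  exact ⟨aux _ (weightV_pos P i) _ fun t => eV_sq_le_energy P _ i,
    aux _ (weightH_pos P i) _ fun t => eH_sq_le_energy P _ i⟩

end Spaces

/-! ### The multiplier form -/

/-- The real bilinear form `Re ∫ x ā b dx` on `𝕃²(0, L)`, which encodes the multiplier `x ∂ₓ`. -/
def moment {L : ℝ} (a b : L2 L) : ℝ := (inner ℂ (mulId L a) b).re

section Moment

variable {L : ℝ}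

theorem moment_comm (hL : 0 < L) (a b : L2 L) : moment a b = moment b a := by
  have ha : MemL2 L a := Lp.memLp a
  have hb : MemL2 L b := Lp.memLp b
  have h : inner ℂ (mulId L a) b = inner ℂ a (mulId L b) := by
    have ea : cls L a = a := by rw [ha.cls_eq]; exact Lp.toLp_coeFn _ _
    have eb : cls L b = b := by rw [hb.cls_eq]; exact Lp.toLp_coeFn _ _
    rw [← ea, ← eb, ha.mulId_cls, hb.mulId_cls, ha.id_mul.inner_cls hL hb,
      ha.inner_cls hL hb.id_mul]
    congr 1
    funext x
    simp only [Complex.star_def, map_mul, Complex.conj_ofReal]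
    ring
  rw [moment, moment, h, ← inner_conj_symm, Complex.conj_re]

theorem moment_add_left (a b c : L2 L) : moment (a + b) c = moment a c + moment b c := by
  simp [moment, inner_add_left]

theorem moment_add_right (a b c : L2 L) : moment a (b + c) = moment a b + moment a c := by
  simp [moment, inner_add_right]

theorem moment_smul_left (r : ℝ) (a b : L2 L) : moment ((r : ℂ) • a) b = r * moment a b := by
  rw [moment, map_smul, inner_smul_left, Complex.conj_ofReal, Complex.re_ofReal_mul, moment]

theorem moment_smul_right (r : ℝ) (a b : L2 L) : moment a ((r : ℂ) • b) = r * moment a b := by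
  rw [moment, inner_smul_right, Complex.re_ofReal_mul, moment]

theorem abs_moment_le (hL : 0 < L) (a b : L2 L) :
    |moment a b| ≤ L * (‖a‖ ^ 2 + ‖b‖ ^ 2) := by
  calc |moment a b| ≤ ‖mulId L a‖ * ‖b‖ :=
        (Complex.abs_re_le_norm _).trans (norm_inner_le_norm _ _)
    _ ≤ L * ‖a‖ * ‖b‖ := by gcongr; exact norm_mulId_le hL a
    _ ≤ L * (‖a‖ ^ 2 + ‖b‖ ^ 2) := by
        rw [mul_assoc]
        gcongr
        nlinarith [sq_nonneg (‖a‖ - ‖b‖), sq_nonneg ‖a‖, sq_nonneg ‖b‖]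

theorem hasDerivAt_re_inner {E : Type*} [NormedAddCommGroup E] [InnerProductSpace ℂ E]
    [NormedSpace ℝ E] {a b : ℝ → E} {a' b' : E} {t : ℝ} (ha : HasDerivAt a a' t)
    (hb : HasDerivAt b b' t) :
    HasDerivAt (fun s => (inner ℂ (a s) (b s)).re)
      ((inner ℂ (a t) b').re + (inner ℂ a' (b t)).re) t := by
  have h := Complex.reCLM.hasFDerivAt.comp_hasDerivAt t (ha.inner ℂ hb)
  simpa [Function.comp_def] using h

theorem hasDerivAt_norm_sq {E : Type*} [NormedAddCommGroup E] [InnerProductSpace ℂ E]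
    [NormedSpace ℝ E] {a : ℝ → E} {a' : E} {t : ℝ} (ha : HasDerivAt a a' t) :
    HasDerivAt (fun s => ‖a s‖ ^ 2) (2 * (inner ℂ (a t) a').re) t := by
  have h := hasDerivAt_re_inner ha ha
  have e : (inner ℂ a' (a t)).re = (inner ℂ (a t) a').re := by
    rw [← inner_conj_symm, Complex.conj_re]
  rw [e, ← two_mul] at h
  refine h.congr_of_eventuallyEq (.of_forall fun s => ?_)
  have := inner_self_eq_norm_sq (𝕜 := ℂ) (a s)
  exact this.symm

theorem hasDerivAt_moment {a b : ℝ → L2 L} {a' b' : L2 L} {t : ℝ} (ha : HasDerivAt a a' t)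
    (hb : HasDerivAt b b' t) :
    HasDerivAt (fun s => moment (a s) (b s)) (moment (a t) b' + moment a' (b t)) t :=
  hasDerivAt_re_inner (((mulId L).restrictScalars ℝ).hasFDerivAt.comp_hasDerivAt t ha) hb

theorem continuousOn_moment {a b : ℝ → L2 L} {s : Set ℝ} (ha : ContinuousOn a s)
    (hb : ContinuousOn b s) : ContinuousOn (fun t => moment (a t) (b t)) s :=
  Complex.continuous_re.comp_continuousOn
    (((mulId L).continuous.comp_continuousOn ha).inner hb)

/-- Pairing with `x` turns `∂ₓ` into a boundary term at `x = L` minus a square. -/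
theorem HasAEDeriv.two_mul_moment (hL : 0 < L) {u u' : ℝ → ℂ} (hu : HasAEDeriv L u u')
    (hu' : MemL2 L u') :
    2 * moment (cls L u) (cls L u') = L * ‖u L‖ ^ 2 - ‖cls L u‖ ^ 2 := by
  have h := congrArg Complex.re (hu.integral_id_mul_parts hL hu' hu hu')
  have h2 := hu.memL2 hL
  rw [← h2.id_mul.inner_cls hL hu', ← hu'.id_mul.inner_cls hL h2, ← h2.inner_cls hL h2,
    ← h2.mulId_cls, ← hu'.mulId_cls, Complex.add_re, Complex.sub_re, Complex.star_def,
    Complex.mul_conj'] at h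
  have e' : (inner ℂ (cls L u) (cls L u)).re = ‖cls L u‖ ^ 2 := inner_self_eq_norm_sq (𝕜 := ℂ) _
  have e := moment_comm hL (cls L u') (cls L u)
  unfold moment at e ⊢
  rw [e, e', Complex.re_ofReal_mul] at h
  norm_cast at h
  linarith

/-- The multiplier identity for a flux `w e` that satisfies a weak form on `H¹_L` with source `g`
and natural boundary condition `w e (L) = c`. -/
theorem two_mul_moment_of_weak (hL : 0 < L) {g e : ℝ → ℂ} (hg : MemL2 L g) (he : MemL2 L e)
    {w : ℝ} (hw : 0 < w) (c : ℂ) (h : ∀ ψ, MemH1L L ψ →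
      inner ℂ (cls L ψ) (cls L g) + w * inner ℂ (cls L (dx L ψ)) (cls L e) = c * star (ψ L)) :
    2 * moment (cls L e) (cls L g) = L * (‖c‖ ^ 2 / w) - w * ‖cls L e‖ ^ 2 := by
  obtain ⟨A, hA, hAL, hAe⟩ := exists_hasAEDeriv_of_weak hL hg (he.const_mul w) c (fun ψ hψ => by
    rw [← h ψ hψ, (hψ.1.memL2 hL).inner_cls hL hg, ← inner_smul_right,
      ← he.cls_const_mul, hψ.1.2.inner_cls hL (he.const_mul w)])
  have h1 := hA.two_mul_moment hL hg
  rw [← cls_congr hAe, he.cls_const_mul, moment_smul_left, norm_smul, hAL, Complex.norm_real,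
    Real.norm_of_nonneg hw.le] at h1
  field_simp
  linarith

end Moment

/-! ### Virtual displacements -/

/-- The quadruple with the given components. -/
def quad (a b c d : ℝ → ℂ) : Quad
  | .v1 => a
  | .v3 => b
  | .p => c
  | .w => d

theorem dx_zero (L : ℝ) : dx L (fun _ => 0) = fun _ => 0 := by
  funext x; simp [dx]

theorem memL2_zero (L : ℝ) : MemL2 L (fun _ => 0) := MemLp.zero

theorem memH1L_zero (L : ℝ) : MemH1L L (fun _ => 0) :=
  ⟨(HasAEDeriv.const 0).memH1 (memL2_zero L), rfl⟩

theorem memH2L_zero (L : ℝ) : MemH2L L (fun _ => 0) := by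
  refine ⟨⟨differentiableOn_const 0, ?_⟩, rfl, ?_⟩
  · rw [dx_zero]; exact (memH1L_zero L).1
  · rw [dx_zero]

/-- The kinematic constraints of an inertial sliding motion: no bending and no shear of the
core. -/
structure IsSlidingState (P : Params) (φ : State) : Prop where
  w : ∀ x ∈ Icc 0 P.L, φ.1 .w x = 0
  w' : ∀ x ∈ Icc 0 P.L, φ.2 .w x = 0
  v : ∀ x ∈ Icc 0 P.L, φ.1 .v1 x = φ.1 .v3 x
  v' : ∀ x ∈ Icc 0 P.L, φ.2 .v1 x = φ.2 .v3 x

/-! ### The closed-loop equation at a sliding state -/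

section ClosedLoop

variable {P : Params} {φ f φ' f' : State}

theorem inputWork_feedback (P : Params) (φ : State) (ψ : Quad) :
    inputWork P.L (feedback P φ) ψ = -P.k1 * φ.2 .v1 P.L * star (ψ .v1 P.L)
      - P.k2 * φ.2 .p P.L * star (ψ .p P.L)
      - P.k3 * dx P.L (φ.2 .w) P.L * star (dx P.L (ψ .w) P.L)
      - P.k4 * φ.2 .w P.L * star (ψ .w P.L) := by
  simp only [inputWork, feedback]
  ring

theorem IsClosedLoop.sub (h : IsClosedLoop P φ f) (h' : IsClosedLoop P φ' f') :
    IsClosedLoop P (φ - φ') (f - f') := by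
  obtain ⟨hz, hy, hf, he, hv⟩ := h
  obtain ⟨hz', hy', hf', he', hv'⟩ := h'
  refine ⟨hz.sub hz', hy.sub hy', hf.sub hf', fun c x hx => ?_, fun ψ hψ => ?_⟩
  · change f.1 c x - f'.1 c x = φ.2 c x - φ'.2 c x
    rw [he c x hx, he' c x hx]
  · have e1 : innerH P (f - f').2 ψ = innerH P f.2 ψ - innerH P f'.2 ψ := by
      rw [innerH_eq hf hψ.memH, innerH_eq hf' hψ.memH, Prod.snd_sub,
        innerH_eq (hf.sub hf') hψ.memH, ← Finset.sum_sub_distrib]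
      refine Finset.sum_congr rfl fun i _ => ?_
      rw [eH_sub hf hf', inner_sub_right, mul_sub]
    have e2 : innerV P (φ - φ').1 ψ = innerV P φ.1 ψ - innerV P φ'.1 ψ := by
      rw [innerV_eq hz hψ, innerV_eq hz' hψ, Prod.fst_sub, innerV_eq (hz.sub hz') hψ,
        ← Finset.sum_sub_distrib]
      refine Finset.sum_congr rfl fun i _ => ?_
      rw [eV_sub hz hz', inner_sub_right, mul_sub]
    have e3 := hy.2.2.2.1.dx_sub P.L_pos hy'.2.2.2.1 (right_mem_Icc.2 P.L_pos.le)
    have e4 : dx P.L ((φ - φ').2 .w) P.L = dx P.L (φ.2 .w) P.L - dx P.L (φ'.2 .w) P.L := e3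
    have h1 := hv ψ hψ
    have h2 := hv' ψ hψ
    rw [inputWork_feedback] at h1 h2 ⊢
    rw [e1, e2, e4]
    simp only [Prod.snd_sub, Pi.sub_apply]
    linear_combination h1 - h2

theorem eV_bending_eq_zero {z : Quad} (hw : ∀ x ∈ Icc 0 P.L, z .w x = 0) : eV P z 1 = 0 := by
  have h : EqOn (z .w) (fun _ => 0) (Icc 0 P.L) := hw
  have h2 := dx_congr (dx_congr h)
  rw [dx_zero, dx_zero] at h2
  exact (cls_congr h2.ae_restrict_Ioo).trans cls_zero

theorem eV_shear_eq_zero {z : Quad} (hw : ∀ x ∈ Icc 0 P.L, z .w x = 0)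
    (hv : ∀ x ∈ Icc 0 P.L, z .v1 x = z .v3 x) : eV P z 2 = 0 := by
  have h : EqOn (z .w) (fun _ => 0) (Icc 0 P.L) := hw
  have h2 := dx_congr h
  rw [dx_zero] at h2
  have h3 : EqOn (strainV P z 2) (fun _ => 0) (Icc 0 P.L) := fun x hx => by
    simp [strainV, h2 hx, hv x hx]
  exact (cls_congr h3.ae_restrict_Ioo).trans cls_zero

theorem eH_rotation_eq_zero {y : Quad} (hw : ∀ x ∈ Icc 0 P.L, y .w x = 0) :
    eH P y 3 = 0 ∧ eH P y 4 = 0 := by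
  have h : EqOn (y .w) (fun _ => 0) (Icc 0 P.L) := hw
  have h2 := dx_congr h
  rw [dx_zero] at h2
  exact ⟨(cls_congr h.ae_restrict_Ioo).trans cls_zero,
    (cls_congr h2.ae_restrict_Ioo).trans cls_zero⟩

theorem dx_w_eq_zero {y : Quad} (hw : ∀ x ∈ Icc 0 P.L, y .w x = 0) {x : ℝ}
    (hx : x ∈ Icc 0 P.L) : dx P.L (y .w) x = 0 := by
  have h : EqOn (y .w) (fun _ => 0) (Icc 0 P.L) := hw
  have h2 := dx_congr h
  rw [dx_zero] at h2
  exact h2 hx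

/-- The power extracted by the boundary dampers from a sliding motion. -/
def dissipation (P : Params) (φ : State) : ℝ :=
  P.k1 * ‖φ.2 .v1 P.L‖ ^ 2 + P.k2 * ‖φ.2 .p P.L‖ ^ 2

theorem dissipation_nonneg (P : Params) (φ : State) : 0 ≤ dissipation P φ := by
  have := P.k1_pos; have := P.k2_pos
  unfold dissipation; positivity

/-- The energy balance: test the closed-loop equation with the velocity. -/
theorem IsClosedLoop.energy_balance (h : IsClosedLoop P φ f) (hs : IsSlidingState P φ) :
    ∑ i, weightV P i * (inner ℂ (eV P φ.1 i) (eV P f.1 i)).re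
      + ∑ i, weightH P i * (inner ℂ (eH P φ.2 i) (eH P f.2 i)).re = -dissipation P φ := by
  obtain ⟨hz, hy, hf, he, hv⟩ := h
  have h1 := congrArg Complex.re (hv φ.2 hy)
  rw [inputWork_feedback, innerH_eq hf hy.memH, innerV_eq hz hy, Complex.add_re, Complex.re_sum,
    Complex.re_sum, hs.w' _ (right_mem_Icc.2 P.L_pos.le),
    dx_w_eq_zero hs.w' (right_mem_Icc.2 P.L_pos.le), mul_assoc, mul_assoc (P.k2 : ℂ),
    Complex.star_def, Complex.mul_conj', Complex.mul_conj'] at h1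
  simp only [Complex.re_ofReal_mul, mul_zero, zero_mul, sub_zero] at h1
  have e : ∀ i, (inner ℂ (eV P φ.1 i) (eV P f.1 i)).re = (inner ℂ (eV P φ.2 i) (eV P φ.1 i)).re :=
    fun i => by rw [eV_congr he i, ← inner_conj_symm, Complex.conj_re]
  simp only [e]
  rw [add_comm, h1, dissipation, ← Complex.ofReal_neg, Complex.sub_re, Complex.re_ofReal_mul,
    Complex.re_ofReal_mul]
  norm_cast
  ring

/-- The boundary terms at `x = L` that the multiplier produces. -/
def boundaryTerm (P : Params) (φ : State) : ℝ :=
  P.ρ1 * P.h1 * ‖φ.2 .v1 P.L‖ ^ 2 + P.ρ3 * P.h3 * ‖φ.2 .v3 P.L‖ ^ 2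
    + P.μ * P.h3 * ‖φ.2 .p P.L‖ ^ 2
    + ‖-P.k1 * φ.2 .v1 P.L‖ ^ 2 / (P.α1 * P.h1)
    + ‖-P.k2 * P.γ * φ.2 .p P.L‖ ^ 2 / (P.α31 * P.h3)
    + ‖-P.k2 * φ.2 .p P.L‖ ^ 2 / (P.β * P.h3)

/-- The multiplier functional `Re ∫ x (ρ₁h₁ v̇¹ v̄¹ₓ + ρ₃h₃ v̇³ v̄³ₓ + μh₃ ṗ p̄ₓ) dx`; here `pₓ` is
recovered from the deformations as `(pₓ - γ v³ₓ) + γ v³ₓ`. -/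
def multiplier (P : Params) (e y : Fin 5 → L2 P.L) : ℝ :=
  P.ρ1 * P.h1 * moment (e 0) (y 0) + P.ρ3 * P.h3 * moment (e 3) (y 1)
    + P.μ * P.h3 * moment (e 4 + (P.γ : ℂ) • e 3) (y 2)

/-- The multiplier identity. The choice of the virtual displacement `(0, ψ, γψ, 0)` for the
piezoelectric layer decouples the fluxes: its flux is `α₁³h₃ v³ₓ`. -/
theorem IsClosedLoop.multiplier_identity (h : IsClosedLoop P φ f) (hs : IsSlidingState P φ) :
    2 * (multiplier P (eV P φ.1) (eH P f.2) + multiplier P (eV P f.1) (eH P φ.2)) =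
      P.L * boundaryTerm P φ - energy P φ := by
  obtain ⟨hz, hy, hf, he, hv⟩ := h
  have hL := P.L_pos
  have e1 : eV P φ.1 1 = 0 := eV_bending_eq_zero hs.w
  have e2 : eV P φ.1 2 = 0 := eV_shear_eq_zero hs.w hs.v
  obtain ⟨y3, y4⟩ := eH_rotation_eq_zero hs.w'
  have eVf : eV P f.1 = eV P φ.2 := funext (eV_congr he)
  -- the kinetic terms
  have k0 := (hy.1.1.hasAEDeriv hL).two_mul_moment hL hy.1.1.2
  have k1 := (hy.2.1.1.hasAEDeriv hL).two_mul_moment hL hy.2.1.1.2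
  have k2 := (hy.2.2.1.1.hasAEDeriv hL).two_mul_moment hL hy.2.2.1.1.2
  have ep : eV P φ.2 4 + (P.γ : ℂ) • eV P φ.2 3 = cls P.L (dx P.L (φ.2 .p)) := by
    rw [eV, eV, ← MemL2.cls_const_mul _ (hy.memL2_strainV 3), ← MemL2.cls_add (hy.memL2_strainV 4)
      ((hy.memL2_strainV 3).const_mul _)]
    refine cls_congr (.of_forall fun x => ?_)
    simp [strainV]
  -- the weak form against virtual displacements without bending
  have weak : ∀ a b c : ℝ → ℂ, MemH1L P.L a → MemH1L P.L b → MemH1L P.L c →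
      (P.ρ1 * P.h1 : ℝ) * inner ℂ (cls P.L a) (eH P f.2 0)
        + (P.ρ3 * P.h3 : ℝ) * inner ℂ (cls P.L b) (eH P f.2 1)
        + (P.μ * P.h3 : ℝ) * inner ℂ (cls P.L c) (eH P f.2 2)
        + ((P.α1 * P.h1 : ℝ) * inner ℂ (cls P.L (dx P.L a)) (eV P φ.1 0)
          + (P.α31 * P.h3 : ℝ) * inner ℂ (cls P.L (dx P.L b)) (eV P φ.1 3)
          + (P.β * P.h3 : ℝ) * inner ℂ (cls P.L (fun x => dx P.L c x - P.γ * dx P.L b x))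
              (eV P φ.1 4))
        = -P.k1 * φ.2 .v1 P.L * star (a P.L) - P.k2 * φ.2 .p P.L * star (c P.L) := by
    intro a b c ha hb hc
    have hψ : MemV P.L (quad a b c fun _ => 0) := ⟨ha, hb, hc, memH2L_zero _⟩
    have q := hv _ hψ
    obtain ⟨z3, z4⟩ := eH_rotation_eq_zero (P := P) (y := quad a b c fun _ => 0) fun _ _ => rfl
    rw [inputWork_feedback, innerH_eq hf hψ.memH, innerV_eq hz hψ, Fin.sum_univ_five,
      Fin.sum_univ_five, e1, e2, z3, z4] at q
    simp only [inner_zero_left, inner_zero_right, mul_zero, add_zero] at q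
    have d0 : star (dx P.L (quad a b c (fun _ => 0) .w) P.L) = 0 := by
      simp [quad, dx_zero]
    have d1 : star (quad a b c (fun _ => 0) .w P.L) = 0 := by simp [quad]
    rw [d0, d1, mul_zero, mul_zero, sub_zero, sub_zero] at q
    exact q
  have p0 := two_mul_moment_of_weak hL (hf.memL2_strainH 0 |>.const_mul (P.ρ1 * P.h1 : ℝ))
    (hz.memL2_strainV 0) (weightV_pos P 0) (-P.k1 * φ.2 .v1 P.L) (fun ψ hψ => by
      have q := weak ψ (fun _ => 0) (fun _ => 0) hψ (memH1L_zero _) (memH1L_zero _)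
      simp only [dx_zero, cls_zero, inner_zero_left, mul_zero, sub_zero, add_zero,
        star_zero] at q
      rw [(hf.memL2_strainH 0).cls_const_mul, inner_smul_right]
      exact q)
  have p4 := two_mul_moment_of_weak hL (hf.memL2_strainH 2 |>.const_mul (P.μ * P.h3 : ℝ))
    (hz.memL2_strainV 4) (weightV_pos P 4) (-P.k2 * φ.2 .p P.L) (fun ψ hψ => by
      have q := weak (fun _ => 0) (fun _ => 0) ψ (memH1L_zero _) (memH1L_zero _) hψ
      simp only [dx_zero, cls_zero, inner_zero_left, mul_zero, sub_zero, zero_add,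
        star_zero, zero_sub] at q
      rw [(hf.memL2_strainH 2).cls_const_mul, inner_smul_right]
      refine Eq.trans q ?_
      ring)
  have p3 := two_mul_moment_of_weak hL
    ((hf.memL2_strainH 1 |>.const_mul (P.ρ3 * P.h3 : ℝ)).add
      (hf.memL2_strainH 2 |>.const_mul (P.μ * P.h3 * P.γ : ℝ)))
    (hz.memL2_strainV 3) (weightV_pos P 3) (-P.k2 * P.γ * φ.2 .p P.L) (fun ψ hψ => by
      have q := weak (fun _ => 0) ψ (fun x => P.γ * ψ x) (memH1L_zero _) hψ
        (hψ.const_mul hL P.γ)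
      have d : cls P.L (fun x => dx P.L (fun x => P.γ * ψ x) x - P.γ * dx P.L ψ x) = 0 := by
        rw [← cls_zero]
        refine cls_congr ?_
        filter_upwards [hψ.1.dx_const_mul hL P.γ] with x hx
        rw [hx, sub_self]
      rw [d, (hψ.1.memL2 hL).cls_const_mul] at q
      simp only [dx_zero, cls_zero, inner_zero_left, mul_zero, zero_add, add_zero,
        star_zero, zero_sub, inner_smul_left, Complex.conj_ofReal] at q
      rw [((hf.memL2_strainH 1).const_mul _).cls_add ((hf.memL2_strainH 2).const_mul _),
        (hf.memL2_strainH 1).cls_const_mul, (hf.memL2_strainH 2).cls_const_mul,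
        inner_add_right, inner_smul_right, inner_smul_right]
      simp only [Complex.star_def, map_mul, Complex.conj_ofReal] at q ⊢
      push_cast at q ⊢
      refine Eq.trans ?_ (q.trans ?_)
      · simp only [weightV, eH, eV, Matrix.cons_val]
        push_cast
        ring
      · ring)
  rw [(hf.memL2_strainH 0).cls_const_mul, moment_smul_right] at p0
  rw [(hf.memL2_strainH 2).cls_const_mul, moment_smul_right] at p4
  rw [((hf.memL2_strainH 1).const_mul _).cls_add ((hf.memL2_strainH 2).const_mul _),
    (hf.memL2_strainH 1).cls_const_mul, (hf.memL2_strainH 2).cls_const_mul, moment_add_right,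
    moment_smul_right, moment_smul_right] at p3
  rw [moment_comm hL] at k0 k1 k2
  rw [eVf, multiplier, multiplier, ep, moment_add_left, moment_smul_left, boundaryTerm, energy,
    Fin.sum_univ_five, Fin.sum_univ_five, e1, e2, y3, y4]
  simp only [weightV, weightH, Matrix.cons_val, norm_zero] at p0 p3 p4 ⊢
  simp only [eV, eH] at p0 p3 p4 ⊢
  simp only [strainH, strainV, Matrix.cons_val] at p0 p3 p4 k0 k1 k2 ⊢
  linear_combination p0 + p3 + p4 + P.ρ1 * P.h1 * k0 + P.ρ3 * P.h3 * k1 + P.μ * P.h3 * k2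

end ClosedLoop

/-! ### Decay of strong sliding solutions -/

/-- The Lyapunov function `(t + C₃ + 2 C₁) E(t) + 2 G(t)` is nonincreasing, whence a decay rate
`1 / t` for the energy `E`. -/
theorem mul_le_of_lyapunov {E G D : ℝ → ℝ} {C1 C3 : ℝ} (hC1 : 0 ≤ C1) (hC3 : 0 ≤ C3)
    (hE : ContinuousOn E (Ici 0)) (hG : ContinuousOn G (Ici 0))
    (hE' : ∀ t, 0 < t → HasDerivAt E (-2 * D t) t)
    (hG' : ∀ t, 0 < t → ∃ g, HasDerivAt G g t ∧ g ≤ C3 * D t - E t / 2)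
    (hD : ∀ t, 0 < t → 0 ≤ D t) (hE0 : ∀ t, 0 ≤ E t)
    (hGE : ∀ t, 0 ≤ t → |G t| ≤ C1 * E t) {t : ℝ} (ht : 0 ≤ t) :
    t * E t ≤ (C3 + 4 * C1) * E 0 := by
  choose! g hg hgle using hG'
  have hderiv : ∀ s, 0 < s → HasDerivAt (fun s => (s + (C3 + 2 * C1)) * E s + 2 * G s)
      (1 * E s + (s + (C3 + 2 * C1)) * (-2 * D s) + 2 * g s) s := fun s hs =>
    (((hasDerivAt_id s).add_const _).mul (hE' s hs)).add ((hg s hs).const_mul 2)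
  have hanti : AntitoneOn (fun s => (s + (C3 + 2 * C1)) * E s + 2 * G s) (Ici 0) := by
    refine antitoneOn_of_deriv_nonpos (convex_Ici 0) ?_ ?_ ?_
    · exact ((continuousOn_id.add continuousOn_const).mul hE).add (continuousOn_const.mul hG)
    · rw [interior_Ici]
      exact fun s hs => (hderiv s hs).differentiableAt.differentiableWithinAt
    · rw [interior_Ici]
      intro s hs
      rw [(hderiv s hs).deriv]
      have h1 := hgle s hs
      have h2 : 0 ≤ (s + 2 * C1) * D s := mul_nonneg (by have : 0 < s := hs; linarith) (hD s hs)
      nlinarith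
  have h := hanti self_mem_Ici ht ht
  simp only [zero_add] at h
  have h1 := abs_le.1 (hGE t ht)
  have h2 := abs_le.1 (hGE 0 le_rfl)
  have h3 := mul_nonneg hC3 (hE0 t)
  linarith

/-- A sliding motion `Ψ` in the domain of the closed-loop operator, with derivative `f = Ψ'` in the
energy norm. -/
structure IsStrongSliding (P : Params) (Ψ f : ℝ → State) : Prop where
  rate : ∀ t, 0 ≤ t → IsClosedLoop P (Ψ t) (f t)
  sliding : ∀ t, 0 ≤ t → IsSlidingState P (Ψ t)
  derivV : ∀ i t, 0 ≤ t →
    HasDerivWithinAt (fun s => eV P (Ψ s).1 i) (eV P (f t).1 i) (Ici 0) t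
  derivH : ∀ i t, 0 ≤ t →
    HasDerivWithinAt (fun s => eH P (Ψ s).2 i) (eH P (f t).2 i) (Ici 0) t

section Strong

variable {P : Params} {Ψ f : ℝ → State}

theorem IsStrongSliding.hasDerivAt_energy (h : IsStrongSliding P Ψ f) {t : ℝ} (ht : 0 < t) :
    HasDerivAt (fun s => energy P (Ψ s)) (-2 * dissipation P (Ψ t)) t := by
  have hn := Ici_mem_nhds ht
  have h1 : HasDerivAt (fun s => energy P (Ψ s))
      (∑ i, weightV P i * (2 * (inner ℂ (eV P (Ψ t).1 i) (eV P (f t).1 i)).re)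
        + ∑ i, weightH P i * (2 * (inner ℂ (eH P (Ψ t).2 i) (eH P (f t).2 i)).re)) t :=
    (HasDerivAt.fun_sum fun i _ =>
        (hasDerivAt_norm_sq ((h.derivV i t ht.le).hasDerivAt hn)).const_mul (weightV P i)).add
      (HasDerivAt.fun_sum fun i _ =>
        (hasDerivAt_norm_sq ((h.derivH i t ht.le).hasDerivAt hn)).const_mul (weightH P i))
  convert h1 using 1
  have e := (h.rate t ht.le).energy_balance (h.sliding t ht.le)
  rw [neg_mul, ← mul_neg, ← e, mul_add, Finset.mul_sum, Finset.mul_sum]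
  congr 1 <;> exact Finset.sum_congr rfl fun i _ => by ring

theorem IsStrongSliding.hasDerivAt_multiplier (h : IsStrongSliding P Ψ f) {t : ℝ} (ht : 0 < t) :
    HasDerivAt (fun s => multiplier P (eV P (Ψ s).1) (eH P (Ψ s).2))
      ((P.L * boundaryTerm P (Ψ t) - energy P (Ψ t)) / 2) t := by
  have hn := Ici_mem_nhds ht
  have dV := fun i => (h.derivV i t ht.le).hasDerivAt hn
  have dH := fun i => (h.derivH i t ht.le).hasDerivAt hn
  have h1 := (((hasDerivAt_moment (dV 0) (dH 0)).const_mul (P.ρ1 * P.h1)).add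
    ((hasDerivAt_moment (dV 3) (dH 1)).const_mul (P.ρ3 * P.h3))).add
    ((hasDerivAt_moment ((dV 4).add ((dV 3).const_smul (P.γ : ℂ))) (dH 2)).const_mul (P.μ * P.h3))
  have e := (h.rate t ht.le).multiplier_identity (h.sliding t ht.le)
  refine HasDerivAt.congr_deriv h1 ?_
  rw [← e, multiplier, multiplier]
  simp only [Pi.add_apply, Pi.smul_apply]
  ring

theorem IsStrongSliding.continuousOn_energy (h : IsStrongSliding P Ψ f) :
    ContinuousOn (fun s => energy P (Ψ s)) (Ici 0) := by
  have cV := fun i => ContinuousOn.norm fun t ht => (h.derivV i t ht).continuousWithinAt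
  have cH := fun i => ContinuousOn.norm fun t ht => (h.derivH i t ht).continuousWithinAt
  exact (continuousOn_finsetSum _ fun i _ => continuousOn_const.mul ((cV i).pow 2)).add
    (continuousOn_finsetSum _ fun i _ => continuousOn_const.mul ((cH i).pow 2))

theorem IsStrongSliding.continuousOn_multiplier (h : IsStrongSliding P Ψ f) :
    ContinuousOn (fun s => multiplier P (eV P (Ψ s).1) (eH P (Ψ s).2)) (Ici 0) := by
  have cV : ∀ i, ContinuousOn (fun s => eV P (Ψ s).1 i) (Ici 0) :=
    fun i t ht => (h.derivV i t ht).continuousWithinAt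
  have cH : ∀ i, ContinuousOn (fun s => eH P (Ψ s).2 i) (Ici 0) :=
    fun i t ht => (h.derivH i t ht).continuousWithinAt
  exact ((continuousOn_const.mul (continuousOn_moment (cV 0) (cH 0))).add
    (continuousOn_const.mul (continuousOn_moment (cV 3) (cH 1)))).add
    (continuousOn_const.mul (continuousOn_moment ((cV 4).add
      (show ContinuousOn (fun s => (P.γ : ℂ) • eV P (Ψ s).1 3) (Ici 0) from
        (cV 3).const_smul (P.γ : ℂ))) (cH 2)))

/-- The dampers control the boundary terms of the multiplier. The undamped velocity `v̇³(L)` is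
controlled because it equals `v̇¹(L)`. -/
theorem exists_boundaryTerm_le (P : Params) : ∃ C : ℝ, 0 ≤ C ∧ ∀ φ : State, IsSlidingState P φ →
    boundaryTerm P φ ≤ C * dissipation P φ := by
  have := P.k1_pos; have := P.k2_pos; have := P.ρ1_pos; have := P.ρ3_pos; have := P.h1_pos
  have := P.h3_pos; have := P.μ_pos; have := P.α1_pos; have := P.α31_pos; have := P.β_pos
  set A := P.ρ1 * P.h1 + P.ρ3 * P.h3 + P.k1 ^ 2 / (P.α1 * P.h1) with hA
  set B := P.μ * P.h3 + (P.k2 * P.γ) ^ 2 / (P.α31 * P.h3) + P.k2 ^ 2 / (P.β * P.h3) with hB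
  have hA0 : 0 ≤ A := by positivity
  have hB0 : 0 ≤ B := by positivity
  refine ⟨A / P.k1 + B / P.k2, by positivity, fun φ hs => ?_⟩
  have e : boundaryTerm P φ = A * ‖φ.2 .v1 P.L‖ ^ 2 + B * ‖φ.2 .p P.L‖ ^ 2 := by
    rw [boundaryTerm, ← hs.v' _ (right_mem_Icc.2 P.L_pos.le)]
    simp only [norm_mul, norm_neg, Complex.norm_real, mul_pow, Real.norm_eq_abs, sq_abs]
    rw [hA, hB]
    ring
  have e1 : A * ‖φ.2 .v1 P.L‖ ^ 2 = A / P.k1 * (P.k1 * ‖φ.2 .v1 P.L‖ ^ 2) := by field_simp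
  have e2 : B * ‖φ.2 .p P.L‖ ^ 2 = B / P.k2 * (P.k2 * ‖φ.2 .p P.L‖ ^ 2) := by field_simp
  rw [e, e1, e2, dissipation]
  have h1 : 0 ≤ A / P.k1 * (P.k2 * ‖φ.2 .p P.L‖ ^ 2) := by positivity
  have h2 : 0 ≤ B / P.k2 * (P.k1 * ‖φ.2 .v1 P.L‖ ^ 2) := by positivity
  linarith

theorem exists_abs_multiplier_le (P : Params) : ∃ C : ℝ, 0 ≤ C ∧ ∀ φ : State,
    |multiplier P (eV P φ.1) (eH P φ.2)| ≤ C * energy P φ := by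
  have hL := P.L_pos
  have := P.ρ1_pos; have := P.ρ3_pos; have := P.h1_pos
  have := P.h3_pos; have := P.μ_pos
  have wV := weightV_pos P
  have wH := weightH_pos P
  refine ⟨P.ρ1 * P.h1 * P.L * ((weightV P 0)⁻¹ + (weightH P 0)⁻¹)
    + P.ρ3 * P.h3 * P.L * ((weightV P 3)⁻¹ + (weightH P 1)⁻¹)
    + P.μ * P.h3 * P.L * ((weightV P 4)⁻¹ + (weightH P 2)⁻¹)
    + P.μ * P.h3 * |P.γ| * P.L * ((weightV P 3)⁻¹ + (weightH P 2)⁻¹), ?_, fun φ => ?_⟩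
  · have := wV 0; have := wV 3; have := wV 4; have := wH 0; have := wH 1; have := wH 2
    positivity
  have bV : ∀ i, ‖eV P φ.1 i‖ ^ 2 ≤ (weightV P i)⁻¹ * energy P φ := fun i => by
    rw [← div_eq_inv_mul, le_div_iff₀ (wV i), mul_comm]; exact eV_sq_le_energy P φ i
  have bH : ∀ i, ‖eH P φ.2 i‖ ^ 2 ≤ (weightH P i)⁻¹ * energy P φ := fun i => by
    rw [← div_eq_inv_mul, le_div_iff₀ (wH i), mul_comm]; exact eH_sq_le_energy P φ i
  have bM : ∀ (c : ℝ) (_ : 0 ≤ c) i j, c * |moment (eV P φ.1 i) (eH P φ.2 j)|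
      ≤ c * P.L * ((weightV P i)⁻¹ + (weightH P j)⁻¹) * energy P φ := fun c hc i j => by
    rw [mul_assoc, mul_assoc]
    refine mul_le_mul_of_nonneg_left ((abs_moment_le hL _ _).trans ?_) hc
    refine mul_le_mul_of_nonneg_left ?_ hL.le
    rw [add_mul]
    exact add_le_add (bV i) (bH j)
  rw [multiplier, moment_add_left, moment_smul_left, mul_add, ← mul_assoc, add_mul, add_mul,
    add_mul, ← add_assoc]
  refine (abs_add_le _ _).trans (add_le_add ((abs_add_le _ _).trans (add_le_add
    ((abs_add_le _ _).trans (add_le_add ?_ ?_)) ?_)) ?_)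
  · rw [abs_mul, abs_of_nonneg (by positivity : 0 ≤ P.ρ1 * P.h1)]
    exact bM _ (by positivity) _ _
  · rw [abs_mul, abs_of_nonneg (by positivity : 0 ≤ P.ρ3 * P.h3)]
    exact bM _ (by positivity) _ _
  · rw [abs_mul, abs_of_nonneg (by positivity : 0 ≤ P.μ * P.h3)]
    exact bM _ (by positivity) _ _
  · rw [abs_mul, abs_mul, abs_of_nonneg (by positivity : 0 ≤ P.μ * P.h3)]
    exact bM _ (by positivity) _ _

/-- The energy of strong sliding solutions decays at a uniform rate. -/
theorem exists_energy_decay (P : Params) : ∃ C : ℝ, ∀ Ψ f : ℝ → State, IsStrongSliding P Ψ f →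
    ∀ t, 0 ≤ t → t * energy P (Ψ t) ≤ C * energy P (Ψ 0) := by
  obtain ⟨C1, hC1, h1⟩ := exists_abs_multiplier_le P
  obtain ⟨C, hC, h2⟩ := exists_boundaryTerm_le P
  have hL := P.L_pos
  refine ⟨P.L * C / 2 + 4 * C1, fun Ψ f h t ht => ?_⟩
  refine mul_le_of_lyapunov (D := fun t => dissipation P (Ψ t)) hC1 (by positivity)
    h.continuousOn_energy h.continuousOn_multiplier (fun t ht => h.hasDerivAt_energy ht)
    (fun t ht => ⟨_, h.hasDerivAt_multiplier ht, ?_⟩) (fun t _ => dissipation_nonneg P _)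
    (fun t => energy_nonneg P _)
    (fun t _ => h1 _) ht
  have h3 := mul_le_mul_of_nonneg_left (h2 _ (h.sliding t ht.le)) hL.le
  linarith

end Strong

/-! ### Mild sliding solutions -/

section Mild

variable {P : Params} {φ Φ : ℝ → State}

theorem IsClosedLoop.memE {χ f : State} (h : IsClosedLoop P χ f) : MemE P.L χ :=
  ⟨h.1, h.2.1.memH⟩

theorem hasDerivWithinAt_of_energyNorm (hφ : ∀ t, 0 ≤ t → MemE P.L (φ t))
    (hΦ : ∀ t, 0 ≤ t → MemE P.L (Φ t)) {t₀ : ℝ} (ht₀ : 0 ≤ t₀)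
    (h : Tendsto (fun t => energyNorm P ((t - t₀)⁻¹ • (Φ t - Φ t₀) - φ t₀))
      (𝓝[Ici 0 \ {t₀}] t₀) (𝓝 0)) (i : Fin 5) :
    HasDerivWithinAt (fun s => eV P (Φ s).1 i) (eV P (φ t₀).1 i) (Ici 0) t₀ ∧
      HasDerivWithinAt (fun s => eH P (Φ s).2 i) (eH P (φ t₀).2 i) (Ici 0) t₀ := by
  have hev : ∀ᶠ t in 𝓝[Ici 0 \ {t₀}] t₀, 0 ≤ t := by
    filter_upwards [self_mem_nhdsWithin] with t ht using ht.1
  have hm : ∀ t, 0 ≤ t → MemE P.L ((t - t₀)⁻¹ • (Φ t - Φ t₀)) := fun t ht =>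
    ((hΦ t ht).sub (hΦ t₀ ht₀)).smul _
  obtain ⟨hV, hH⟩ := tendsto_eV_of_energyNorm
    (hev.mono fun t ht => (hm t ht).sub (hφ t₀ ht₀)) h i
  constructor
  · rw [hasDerivWithinAt_iff_tendsto_slope, ← tendsto_sub_nhds_zero_iff]
    refine hV.congr' (hev.mono fun t ht => ?_)
    rw [Prod.fst_sub, eV_sub (hm t ht).1 (hφ t₀ ht₀).1, Prod.smul_fst,
      eV_smul _ ((hΦ t ht).sub (hΦ t₀ ht₀)).1, Prod.fst_sub,
      eV_sub (hΦ t ht).1 (hΦ t₀ ht₀).1, Complex.coe_smul]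
    simp only [slope_def_module]
    rfl
  · rw [hasDerivWithinAt_iff_tendsto_slope, ← tendsto_sub_nhds_zero_iff]
    refine hH.congr' (hev.mono fun t ht => ?_)
    rw [Prod.snd_sub, eH_sub (hm t ht).2 (hφ t₀ ht₀).2, Prod.smul_snd,
      eH_smul _ ((hΦ t ht).sub (hΦ t₀ ht₀)).2, Prod.snd_sub,
      eH_sub (hΦ t ht).2 (hΦ t₀ ht₀).2, Complex.coe_smul]
    simp only [slope_def_module]
    rfl

theorem eq_zero_of_hasDerivWithinAt_zero {E : Type*} [NormedAddCommGroup E] [NormedSpace ℝ E]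
    {a : ℝ → E} (h0 : a 0 = 0) (h : ∀ t, 0 ≤ t → HasDerivWithinAt a 0 (Ici 0) t) {t : ℝ}
    (ht : 0 ≤ t) : a t = 0 := by
  rw [← h0]
  refine constant_of_has_deriv_right_zero (a := 0) (b := t)
    (fun s hs => (h s hs.1).continuousWithinAt.mono Icc_subset_Ici_self)
    (fun s hs => (h s hs.1).mono (Ici_subset_Ici.2 hs.1)) t ⟨ht, le_rfl⟩

theorem hasDerivWithinAt_eq_zero {E : Type*} [NormedAddCommGroup E] [NormedSpace ℝ E]
    {a : ℝ → E} {a' : E} (h0 : ∀ t, 0 ≤ t → a t = 0) {t : ℝ} (ht : 0 ≤ t)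
    (h : HasDerivWithinAt a a' (Ici 0) t) : a' = 0 :=
  (uniqueDiffOn_Ici 0 t ht).eq_deriv _ h
    ((hasDerivWithinAt_const t _ (0 : E)).congr_of_mem (fun s hs => h0 s hs) ht)

theorem MemH2L.eq_zero_of_dx_dx {L : ℝ} (hL : 0 < L) {w : ℝ → ℂ} (hw : MemH2L L w)
    (h : cls L (dx L (dx L w)) = 0) {x : ℝ} (hx : x ∈ Icc 0 L) : w x = 0 := by
  have h1 : ∀ y ∈ Icc 0 L, dx L w y = 0 := fun y hy => by
    rw [(hw.1.2.hasAEDeriv hL).eq_of_ae_zero (hw.1.2.2.ae_zero_of_cls h) hy, hw.2.2]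
  have h2 : EqOn (dx L w) (fun _ => 0) (Icc 0 L) := h1
  rw [(hw.1.hasAEDeriv hL).eq_of_ae_zero h2.ae_restrict_Ioo hx, hw.2.1]

/-- The bending equation forces the shear of the core to vanish when there is no bending: test it
with the virtual bending displacement whose slope is `-v¹ + v³`. -/
theorem IsClosedLoop.shear_eq_zero {χ f : State} (h : IsClosedLoop P χ f)
    (hw : ∀ x ∈ Icc 0 P.L, χ.1 .w x = 0) (hw' : ∀ x ∈ Icc 0 P.L, χ.2 .w x = 0)
    (hf3 : eH P f.2 3 = 0) (hf4 : eH P f.2 4 = 0) {x : ℝ} (hx : x ∈ Icc 0 P.L) :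
    χ.1 .v1 x = χ.1 .v3 x := by
  obtain ⟨hz, hy, hf, -, hv⟩ := h
  have hL := P.L_pos
  have hs : MemH1L P.L (fun x => χ.1 .v3 x - χ.1 .v1 x) := hz.2.1.sub hL hz.1
  have hs2 := hs.1.memL2 hL
  set η : ℝ → ℂ := fun x => ∫ s in (0 : ℝ)..x, (χ.1 .v3 s - χ.1 .v1 s) with hη
  have hd : EqOn (dx P.L η) (fun x => χ.1 .v3 x - χ.1 .v1 x) (Icc 0 P.L) :=
    dx_primitive hL (hs.1.continuousOn hL)
  have hψ : MemV P.L (quad (fun _ => 0) (fun _ => 0) (fun _ => 0) η) :=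
    ⟨memH1L_zero _, memH1L_zero _, memH1L_zero _, memH2L_primitive hL hs⟩
  set ψ := quad (fun _ => 0) (fun _ => 0) (fun _ => 0) η with hψdef
  have q := hv ψ hψ
  have c0 : eH P ψ 0 = 0 := cls_zero
  have c1 : eH P ψ 1 = 0 := cls_zero
  have c2 : eH P ψ 2 = 0 := cls_zero
  have d0 : eV P ψ 0 = 0 := by
    change cls P.L (dx P.L fun _ => 0) = 0
    rw [dx_zero, cls_zero]
  have d3 : eV P ψ 3 = 0 := d0
  have d4 : eV P ψ 4 = 0 := by
    change cls P.L (fun x => dx P.L (fun _ => 0) x - P.γ * dx P.L (fun _ => 0) x) = 0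
    simp [dx_zero, cls_zero]
  have d2 : eV P ψ 2 = (P.H : ℂ) • cls P.L (fun x => χ.1 .v3 x - χ.1 .v1 x) := by
    rw [← hs2.cls_const_mul]
    refine cls_congr (EqOn.ae_restrict_Ioo fun x hx => ?_)
    simp [strainV, hψdef, quad, hd hx]
  have z1 : eV P χ.1 1 = 0 := eV_bending_eq_zero hw
  have z2 : eV P χ.1 2 = cls P.L (fun x => χ.1 .v3 x - χ.1 .v1 x) := by
    refine cls_congr (EqOn.ae_restrict_Ioo fun x hx => ?_)
    simp only [strainV, Matrix.cons_val, dx_w_eq_zero hw hx]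
    ring
  rw [inputWork_feedback, innerH_eq hf hψ.memH, innerV_eq hz hψ, Fin.sum_univ_five,
    Fin.sum_univ_five, c0, c1, c2, hf3, hf4, d0, d3, d4, d2, z1, z2,
    hw' _ (right_mem_Icc.2 hL.le), dx_w_eq_zero hw' (right_mem_Icc.2 hL.le)] at q
  have s1 : star (ψ .v1 P.L) = 0 := star_zero _
  have s2 : star (ψ .p P.L) = 0 := star_zero _
  rw [s1, s2] at q
  simp only [inner_zero_left, inner_zero_right, mul_zero, zero_mul, add_zero, zero_add, sub_zero,
    inner_smul_left, Complex.conj_ofReal, mul_eq_zero, Complex.ofReal_eq_zero, P.H_pos.ne',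
    (weightV_pos P 2).ne', false_or, inner_self_eq_zero] at q
  exact (sub_eq_zero.1 ((hs.1.continuousOn hL).eq_zero_of_ae hL (hs2.ae_zero_of_cls q) hx)).symm

/-- Sliding passes from a mild solution `φ` to its primitive `Φ`. -/
theorem isSlidingState_primitive (hφ : ∀ t, 0 ≤ t → MemE P.L (φ t))
    (hs : IsInertialSliding P φ) (hΦ0 : Φ 0 = 0)
    (hr : ∀ t, 0 ≤ t → IsClosedLoop P (Φ t) (φ t - φ 0))
    (hd : ∀ i t, 0 ≤ t →
      HasDerivWithinAt (fun s => eV P (Φ s).1 i) (eV P (φ t).1 i) (Ici 0) t ∧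
      HasDerivWithinAt (fun s => eH P (Φ s).2 i) (eH P (φ t).2 i) (Ici 0) t)
    {t : ℝ} (ht : 0 ≤ t) : IsSlidingState P (Φ t) := by
  have hL := P.L_pos
  have hw : ∀ t, 0 ≤ t → ∀ x ∈ Icc 0 P.L, (Φ t).1 .w x = 0 := by
    intro t ht x hx
    refine (hr t ht).1.2.2.2.eq_zero_of_dx_dx hL ?_ hx
    refine eq_zero_of_hasDerivWithinAt_zero (a := fun s => eV P (Φ s).1 1) ?_ (fun s hs' => ?_) ht
    · rw [hΦ0]
      exact eV_bending_eq_zero fun _ _ => rfl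
    · have h := (hd 1 s hs').1
      rwa [eV_bending_eq_zero (hs s hs')] at h
  have hw' : ∀ t, 0 ≤ t → ∀ x ∈ Icc 0 P.L, (Φ t).2 .w x = 0 := by
    intro t ht x hx
    rw [← (hr t ht).2.2.2.1 .w x hx]
    change (φ t).1 .w x - (φ 0).1 .w x = 0
    rw [hs t ht x hx, hs 0 le_rfl x hx, sub_zero]
  have h3 : ∀ t, 0 ≤ t → eH P (φ t).2 3 = 0 := fun t ht =>
    hasDerivWithinAt_eq_zero (fun s hs' => (eH_rotation_eq_zero (hw' s hs')).1) ht (hd 3 t ht).2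
  have h4 : ∀ t, 0 ≤ t → eH P (φ t).2 4 = 0 := fun t ht =>
    hasDerivWithinAt_eq_zero (fun s hs' => (eH_rotation_eq_zero (hw' s hs')).2) ht (hd 4 t ht).2
  have hv : ∀ t, 0 ≤ t → ∀ x ∈ Icc 0 P.L, (Φ t).1 .v1 x = (Φ t).1 .v3 x := by
    intro t ht x hx
    refine (hr t ht).shear_eq_zero (hw t ht) (hw' t ht) ?_ ?_ hx
    · rw [Prod.snd_sub, eH_sub (hφ t ht).2 (hφ 0 le_rfl).2, h3 t ht, h3 0 le_rfl, sub_zero]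
    · rw [Prod.snd_sub, eH_sub (hφ t ht).2 (hφ 0 le_rfl).2, h4 t ht, h4 0 le_rfl, sub_zero]
  have hφv : ∀ t, 0 ≤ t → ∀ x ∈ Icc 0 P.L, (φ t).1 .v3 x - (φ t).1 .v1 x = 0 := by
    intro t ht x hx
    have e : eV P (φ t).1 2 = 0 :=
      hasDerivWithinAt_eq_zero (fun s hs' => eV_shear_eq_zero (hw s hs') (hv s hs')) ht
        (hd 2 t ht).1
    have hm := (hφ t ht).1
    refine ((hm.2.1.sub hL hm.1).1.continuousOn hL).eq_zero_of_ae hL ?_ hx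
    filter_upwards [(hm.memL2_strainV 2).ae_zero_of_cls e, ae_restrict_mem measurableSet_Ioo]
      with y hy hy'
    simp only [strainV, Matrix.cons_val, dx_w_eq_zero (hs t ht) (Ioo_subset_Icc_self hy')] at hy
    rw [← hy]
    ring
  refine ⟨hw t ht, hw' t ht, hv t ht, fun x hx => ?_⟩
  rw [← (hr t ht).2.2.2.1 .v1 x hx, ← (hr t ht).2.2.2.1 .v3 x hx]
  change (φ t).1 .v1 x - (φ 0).1 .v1 x = (φ t).1 .v3 x - (φ 0).1 .v3 x
  linear_combination hφv 0 le_rfl x hx - hφv t ht x hx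

theorem IsSlidingState.sub {χ χ' : State} (h : IsSlidingState P χ) (h' : IsSlidingState P χ') :
    IsSlidingState P (χ - χ') where
  w x hx := by change χ.1 .w x - χ'.1 .w x = 0; rw [h.w x hx, h'.w x hx, sub_zero]
  w' x hx := by change χ.2 .w x - χ'.2 .w x = 0; rw [h.w' x hx, h'.w' x hx, sub_zero]
  v x hx := by
    change χ.1 .v1 x - χ'.1 .v1 x = χ.1 .v3 x - χ'.1 .v3 x; rw [h.v x hx, h'.v x hx]
  v' x hx := by
    change χ.2 .v1 x - χ'.2 .v1 x = χ.2 .v3 x - χ'.2 .v3 x; rw [h.v' x hx, h'.v' x hx]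

theorem HasDerivWithinAt.increment {E : Type*} [NormedAddCommGroup E] [NormedSpace ℝ E]
    {a a' : ℝ → E} (ha : ∀ t, 0 ≤ t → HasDerivWithinAt a (a' t) (Ici 0) t) {h : ℝ} (hh : 0 ≤ h)
    {t : ℝ} (ht : 0 ≤ t) :
    HasDerivWithinAt (fun s => a (s + h) - a s) (a' (t + h) - a' t) (Ici 0) t := by
  have h1 := HasDerivWithinAt.scomp t (h := fun s => s + h) (t' := Ici 0)
    (ha (t + h) (add_nonneg ht hh)) ((hasDerivWithinAt_id t (Ici 0)).add_const h)
    (fun s hs => add_nonneg hs hh)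
  rw [one_smul] at h1
  exact h1.sub (ha t ht)

/-- Mild sliding solutions inherit the decay rate of strong ones: the increments
`Φ(t + h) - Φ(t)` of the primitive are strong solutions, and divided by `h` they tend to `φ(t)`. -/
theorem IsMildSolution.exists_energy_decay (hm : IsMildSolution P φ)
    (hs : IsInertialSliding P φ) :
    ∃ C : ℝ, ∀ t, 0 ≤ t → t * energy P (φ t) ≤ C * energy P (φ 0) := by
  obtain ⟨C, hC⟩ := RaoNakra.exists_energy_decay P
  refine ⟨C, fun t ht => ?_⟩
  obtain ⟨Φ, hΦ0, hΦd, hr⟩ := hm.equation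
  have hd : ∀ i t, 0 ≤ t →
      HasDerivWithinAt (fun s => eV P (Φ s).1 i) (eV P (φ t).1 i) (Ici 0) t ∧
      HasDerivWithinAt (fun s => eH P (Φ s).2 i) (eH P (φ t).2 i) (Ici 0) t := fun i t ht =>
    hasDerivWithinAt_of_energyNorm hm.mem (fun s hs' => (hr s hs').memE) ht (hΦd t ht) i
  have hslide := fun t ht => isSlidingState_primitive hm.mem hs hΦ0 hr hd (t := t) ht
  have eVd : ∀ {s h : ℝ}, 0 ≤ s → 0 ≤ h → ∀ i,
      eV P (Φ (s + h) - Φ s).1 i = eV P (Φ (s + h)).1 i - eV P (Φ s).1 i := fun hs' hh i =>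
    eV_sub (hr _ (add_nonneg hs' hh)).1 (hr _ hs').1 i
  have eHd : ∀ {s h : ℝ}, 0 ≤ s → 0 ≤ h → ∀ i,
      eH P (Φ (s + h) - Φ s).2 i = eH P (Φ (s + h)).2 i - eH P (Φ s).2 i := fun hs' hh i =>
    eH_sub (hr _ (add_nonneg hs' hh)).memE.2 (hr _ hs').memE.2 i
  have strong : ∀ h : ℝ, 0 < h →
      IsStrongSliding P (fun s => Φ (s + h) - Φ s) (fun s => φ (s + h) - φ s) := by
    intro h hh
    refine ⟨fun s hs' => ?_, fun s hs' => ?_, fun i s hs' => ?_, fun i s hs' => ?_⟩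
    · have := (hr (s + h) (add_nonneg hs' hh.le)).sub (hr s hs')
      rwa [sub_sub_sub_cancel_right] at this
    · exact (hslide _ (add_nonneg hs' hh.le)).sub (hslide s hs')
    · rw [Prod.fst_sub, eV_sub (hm.mem _ (add_nonneg hs' hh.le)).1 (hm.mem _ hs').1]
      exact (HasDerivWithinAt.increment (fun t ht => (hd i t ht).1) hh.le hs').congr_of_mem
        (fun r hr' => eVd hr' hh.le i) hs'
    · rw [Prod.snd_sub, eH_sub (hm.mem _ (add_nonneg hs' hh.le)).2 (hm.mem _ hs').2]
      exact (HasDerivWithinAt.increment (fun t ht => (hd i t ht).2) hh.le hs').congr_of_mem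
        (fun r hr' => eHd hr' hh.le i) hs'
  -- the scaled energies of the increments converge
  have lim : ∀ s, 0 ≤ s → Tendsto (fun h : ℝ => h⁻¹ ^ 2 * energy P (Φ (s + h) - Φ s))
      (𝓝[>] 0) (𝓝 (energy P (φ s))) := by
    intro s hs'
    have aux : ∀ (a : ℝ → L2 P.L) (a' : L2 P.L), HasDerivWithinAt a a' (Ici 0) s →
        Tendsto (fun h : ℝ => h⁻¹ ^ 2 * ‖a (s + h) - a s‖ ^ 2) (𝓝[>] 0) (𝓝 (‖a'‖ ^ 2)) := by
      intro a a' ha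
      have h0 := HasDerivWithinAt.scomp (h := fun h => s + h) (t' := Ici 0) 0
        (by simpa using ha) ((hasDerivWithinAt_id (0 : ℝ) (Ioi 0)).const_add s)
        (fun r hr' => add_nonneg hs' (le_of_lt hr'))
      rw [one_smul, hasDerivWithinAt_iff_tendsto_slope' self_notMem_Ioi] at h0
      refine (h0.norm.pow 2).congr fun h => ?_
      simp only [slope_def_module, Function.comp_apply, sub_zero, add_zero]
      rw [norm_smul, mul_pow, Real.norm_eq_abs, sq_abs]
    have h1 : Tendsto (fun h : ℝ =>
        ∑ i, weightV P i * (h⁻¹ ^ 2 * ‖eV P (Φ (s + h)).1 i - eV P (Φ s).1 i‖ ^ 2)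
        + ∑ i, weightH P i * (h⁻¹ ^ 2 * ‖eH P (Φ (s + h)).2 i - eH P (Φ s).2 i‖ ^ 2))
        (𝓝[>] 0) (𝓝 (energy P (φ s))) :=
      (tendsto_finsetSum _ fun i _ => (aux _ _ (hd i s hs').1).const_mul (weightV P i)).add
        (tendsto_finsetSum _ fun i _ => (aux _ _ (hd i s hs').2).const_mul (weightH P i))
    refine h1.congr' ?_
    filter_upwards [self_mem_nhdsWithin] with h hh
    have hh' : 0 ≤ h := le_of_lt hh
    simp only [energy, eVd hs' hh', eHd hs' hh', mul_add, Finset.mul_sum]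
    congr 1 <;> exact Finset.sum_congr rfl fun i _ => by ring
  have l0 := (lim 0 le_rfl).const_mul C
  refine le_of_tendsto_of_tendsto ((lim t ht).const_mul t) l0 ?_
  filter_upwards [self_mem_nhdsWithin] with h hh
  have h1 := mul_le_mul_of_nonneg_left (hC _ _ (strong h hh) t ht) (sq_nonneg h⁻¹)
  linarith

theorem IsMildSolution.tendsto_energyNorm (hm : IsMildSolution P φ)
    (hs : IsInertialSliding P φ) : Tendsto (fun t => energyNorm P (φ t)) atTop (𝓝 0) := by
  obtain ⟨C, hC⟩ := hm.exists_energy_decay hs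
  have h : Tendsto (fun t => energy P (φ t)) atTop (𝓝 0) := by
    refine squeeze_zero' (.of_forall fun t => energy_nonneg P _) ?_
      (tendsto_const_nhds (x := C * energy P (φ 0)).div_atTop tendsto_id)
    filter_upwards [eventually_gt_atTop 0] with t ht
    rw [id, le_div_iff₀ ht, mul_comm]
    exact hC t ht.le
  have h2 := h.sqrt
  rw [Real.sqrt_zero] at h2
  refine h2.congr' ?_
  filter_upwards [eventually_ge_atTop 0] with t ht
  rw [← energyNorm_sq (hm.mem t ht)]
  exact Real.sqrt_sq (Real.sqrt_nonneg _)

end Mild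

/-! ### The overdetermined eigenvalue problem -/

/-- Uniqueness for `v'' = -k v`, `k ≥ 0`, with data at `x = L`, through the conserved quantity
`|v'|² + k |v|²`. -/
theorem dx_eq_zero_of_oscillator {L : ℝ} (hL : 0 < L) {v : ℝ → ℂ} (hv : MemH2 L v) {k : ℝ}
    (hk : 0 ≤ k)
    (h : ∀ᵐ x ∂(volume.restrict (Ioo 0 L)), dx L (dx L v) x = -(k : ℂ) * v x)
    (hvL : v L = 0) (hdL : dx L v L = 0) {x : ℝ} (hx : x ∈ Icc 0 L) : dx L v x = 0 := by
  have h1 := hv.hasAEDeriv hL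
  have h2 := hv.2.hasAEDeriv hL
  have hS := (h2.mul h2.conj).add ((h1.mul h1.conj).const_mul k)
  have hS0 := fun y (hy : y ∈ Icc 0 L) => hS.eq_of_ae_zero (by
    filter_upwards [h] with x hx
    rw [hx]
    simp only [Complex.star_def, map_mul, map_neg, Complex.conj_ofReal]
    ring) hy
  have e := (hS0 x hx).trans (hS0 L (right_mem_Icc.2 hL.le)).symm
  simp only [hvL, hdL, zero_mul, mul_zero, add_zero, Complex.star_def, Complex.mul_conj'] at e
  norm_cast at e
  have e1 : 0 ≤ k * ‖v x‖ ^ 2 := by positivity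
  have e2 : ‖dx L v x‖ ^ 2 = 0 := le_antisymm (by linarith) (sq_nonneg _)
  simpa using e2

theorem IsSlidingEigenfunction.eq_zero {P : Params} (hγ : P.γ ≠ 0) {τ : ℝ} {v1 v3 p : ℝ → ℂ}
    (h : IsSlidingEigenfunction P τ v1 v3 p) {x : ℝ} (hx : x ∈ Icc 0 P.L) :
    v1 x = 0 ∧ v3 x = 0 ∧ p x = 0 := by
  have hL := P.L_pos
  have hRL : P.L ∈ Icc 0 P.L := right_mem_Icc.2 hL.le
  have cγ : (P.γ : ℂ) ≠ 0 := by exact_mod_cast hγ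
  have cβ : (P.β : ℂ) ≠ 0 := by exact_mod_cast P.β_pos.ne'
  have ch1 : (P.h1 : ℂ) ≠ 0 := by exact_mod_cast P.h1_pos.ne'
  have ch3 : (P.h3 : ℂ) ≠ 0 := by exact_mod_cast P.h3_pos.ne'
  have cα : (P.α1 : ℂ) ≠ 0 := by exact_mod_cast P.α1_pos.ne'
  have cρ : (P.ρ1 : ℂ) ≠ 0 := by exact_mod_cast P.ρ1_pos.ne'
  have D1 := h.mem_v1.hasAEDeriv hL
  have D3 := h.mem_v3.hasAEDeriv hL
  have Dp := h.mem_p.hasAEDeriv hL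
  have D1' := h.mem_v1.2.hasAEDeriv hL
  have Dp' := h.mem_p.2.hasAEDeriv hL
  -- the shear vanishes
  have hcw : ((P.G2 * P.H / P.h2 : ℝ) : ℂ) ≠ 0 := by
    have := P.G2_pos; have := P.H_pos; have := P.h2_pos
    exact_mod_cast (by positivity : P.G2 * P.H / P.h2 ≠ 0)
  have e13 : EqOn v3 v1 (Icc 0 P.L) := fun y hy => by
    have := (D3.sub D1).eq_of_ae_zero (by
      filter_upwards [h.eq_w] with x hx
      rcases mul_eq_zero.1 hx with h0 | h0
      · exact absurd h0 hcw
      · rw [← h0]; ring) hy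
    rw [h.v3_zero, h.v1_zero, sub_zero] at this
    exact sub_eq_zero.1 this
  have e13' := (dx_congr (dx_congr e13)).ae_restrict_Ioo
  -- the first equation is an oscillator
  have osc : ∀ᵐ x ∂(volume.restrict (Ioo 0 P.L)),
      dx P.L (dx P.L v1) x = -((τ ^ 2 * P.ρ1 / P.α1 : ℝ) : ℂ) * v1 x := by
    filter_upwards [h.eq_v1, e13.ae_restrict_Ioo] with x hx hx'
    rw [hx'] at hx
    push_cast at hx ⊢
    field_simp
    refine mul_left_cancel₀ ch1 ?_
    linear_combination hx
  -- the second equation makes the charge proportional to the displacement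
  set d : ℂ := (P.α3 - P.ρ3 * P.α1 / P.ρ1) / (P.γ * P.β) with hd
  have hpd : ∀ᵐ x ∂(volume.restrict (Ioo 0 P.L)),
      dx P.L (dx P.L p) x = d * dx P.L (dx P.L v1) x := by
    filter_upwards [h.eq_v3, e13.ae_restrict_Ioo, e13', osc] with x hx hx' hx'' ho
    rw [hx', hx''] at hx
    have hv : (τ : ℂ) ^ 2 * P.ρ1 * v1 x = -P.α1 * dx P.L (dx P.L v1) x := by
      rw [ho]; push_cast; field_simp
    rw [hd]
    push_cast at hx
    field_simp
    refine mul_left_cancel₀ ch3 ?_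
    linear_combination (-P.ρ1 : ℂ) * hx + P.h3 * P.ρ3 * hv
  have hdp : ∀ y ∈ Icc 0 P.L, dx P.L p y = d * dx P.L v1 y := fun y hy => by
    have hq := fun y (hy : y ∈ Icc 0 P.L) => (Dp'.sub (D1'.const_mul d)).eq_of_ae_zero (by
      filter_upwards [hpd] with x hx
      rw [hx, sub_self]) hy
    have e := (hq y hy).trans (hq P.L hRL).symm
    rw [h.dx_p_L, h.dx_v1_L, mul_zero, sub_zero] at e
    exact sub_eq_zero.1 e
  have hp : ∀ y ∈ Icc 0 P.L, p y = d * v1 y := fun y hy => by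
    have e := (Dp.sub (D1.const_mul d)).eq_of_ae_zero (by
      filter_upwards [ae_restrict_mem measurableSet_Ioo] with x hx
      rw [hdp x (Ioo_subset_Icc_self hx), sub_self]) hy
    rw [h.p_zero, h.v1_zero, mul_zero, sub_zero] at e
    exact sub_eq_zero.1 e
  have hdx : ∀ y ∈ Icc 0 P.L, dx P.L v1 y = 0 := by
    by_cases hd0 : d = 0
    · -- no charge: the third equation reads `γ v'' = 0`
      have p0 : EqOn p (fun _ => 0) (Icc 0 P.L) := fun y hy => by simp [hp y hy, hd0]
      have hq := fun y (hy : y ∈ Icc 0 P.L) => D1'.eq_of_ae_zero (by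
        filter_upwards [h.eq_p, p0.ae_restrict_Ioo, hpd, e13'] with x hx h0 h2 h3
        rw [h0, h2, h3, hd0] at hx
        simpa [hγ, P.β_pos.ne', P.h3_pos.ne'] using hx) hy
      exact fun y hy => ((hq y hy).trans (hq P.L hRL).symm).trans h.dx_v1_L
    · have hvL : v1 P.L = 0 := by
        have e := hp P.L hRL
        rw [h.p_L] at e
        exact (mul_eq_zero.1 e.symm).resolve_left hd0
      have hk : 0 ≤ τ ^ 2 * P.ρ1 / P.α1 := by
        have := P.ρ1_pos; have := P.α1_pos
        positivity
      exact fun y hy => dx_eq_zero_of_oscillator hL h.mem_v1 hk osc hvL h.dx_v1_L hy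
  have hv : v1 x = 0 := by
    have e : EqOn (dx P.L v1) (fun _ => 0) (Icc 0 P.L) := hdx
    rw [D1.eq_of_ae_zero e.ae_restrict_Ioo hx, h.v1_zero]
  exact ⟨hv, by rw [e13 hx, hv], by rw [hp x hx, hv, mul_zero]⟩

end RaoNakra

end

theorem mainTheorem5 (P : RaoNakra.Params) :
    (∀ φ : ℝ → RaoNakra.State, RaoNakra.IsMildSolution P φ → RaoNakra.IsInertialSliding P φ →
      Filter.Tendsto (fun t => RaoNakra.energyNorm P (φ t)) Filter.atTop (nhds 0)) ∧
    (P.γ ≠ 0 → ∀ (τ : ℝ) (v1 v3 p : ℝ → ℂ), RaoNakra.IsSlidingEigenfunction P τ v1 v3 p →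
      ∀ x ∈ Set.Icc 0 P.L, v1 x = 0 ∧ v3 x = 0 ∧ p x = 0) :=
  ⟨fun _ hm hs => hm.tendsto_energyNorm hs, fun hγ _ _ _ _ h _ hx => h.eq_zero hγ hx⟩
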